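/- Let $K$ be an imaginary quadratic field with ring of integers $\mathcal O_K$. For a positive integer $f$, the order of conductor $f$ in $K$ is $\mathcal O=\mathbb Z+f\mathcal O_K$. A fractional $\mathcal O$-ideal $\mathfrak a$ is proper if $\mathcal O=\{\alpha\in K\mid \alpha\mathfrak a\subset\mathfrak a\}$; the proper fractional $\mathcal O$-ideals form a group $\mathcal I(\mathcal O)$ under multiplication. An $\mathcal O$-ideal $\mathfrak a$ is relatively prime to a positive integer $N$ if $\mathfrak a+N\mathcal O=\mathcal O$. Let $\mathcal I(\mathcal O,N)\subset \mathcal I(\mathcal O)$ be the subgroup generated by the proper $\mathcal O$-ideals relatively prime to $N$, $\mathcal P(\mathcal O,N)$ the subgroup generated by the principal $\mathcal O$-ideals relatively prime to $N$, and $\mathcal P_0(\mathcal O,N)$ the subgroup generated by the nonzero principal ideals $\alpha\mathcal O$ with $\alpha\in\mathcal O$ and $\alpha\equiv a\pmod{N\mathcal O}$ for some $a\in\mathbb Z$ with $\gcd(a,N)=1$. Put $\mathcal C_0(\mathcal O,N)=\mathcal I(\mathcal O,N)/\mathcal P_0(\mathcal O,N)$ and let $\mathcal C(\mathcal O)=\mathcal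 I(\mathcal O,1)/\mathcal P(\mathcal O,1)$ be the ideal class group of $\mathcal O$. For a negative integer $D\equiv 0,1\pmod 4$ and a positive integer $N$, let $\mathcal C(D,\Gamma_0(N))$ be the set of primitive positive definite integral binary quadratic forms $ax^2+bxy+cy^2$ with $b^2-4ac=D$ and $\gcd(a,N)=1$, modulo $\Gamma_0(N)$-equivalence, where $Q'$ is $\Gamma_0(N)$-equivalent to $Q$ if $Q'(x,y)=Q(px+qy,rx+sy)$ for some $\begin{pmatrix}p&q\\r&s\end{pmatrix}\in\Gamma_0(N)$; put $\mathcal C(D)=\mathcal C(D,\Gamma_0(1))$. If $Q=ax^2+bxy+cy^2$ and $Q'=a'x^2+b'xy+c'y^2$ are two such forms with $\gcd(a,a',\frac{b+b'}2)=1$, then a Dirichlet composition of $Q$ and $Q'$ is a form $aa'x^2+Bxy+\frac{B^2-D}{4aa'}y^2$ where the integer $B$ satisfies $B\equiv b\pmod{2a}$, $B\equiv b'\pmod{2a'}$ and $B^2\equiv D\pmod{4aa'}$. (1) Let $f,N$ be positive integers and let $\mathcal O$ and $\mathcal O'$ be the orders of conductor $f$ and $Nf$, respectively, in an imaginary quadratic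 field $K$. Then there is a group isomorphism $$\mathcal C_0(\mathcal O,N)\cong\mathcal C(\mathcal O').$$ (2) Let $N$ be a positive integer and let $D\equiv 0,1\pmod 4$ be a negative integer. Then Dirichlet composition of representatives makes $\mathcal C(D,\Gamma_0(N))$ and $\mathcal C(DN^2)$ abelian groups (any two classes have representatives to which it applies, and the class of the composition depends only on the two classes), and there is a group isomorphism $$\mathcal C(D,\Gamma_0(N))\cong\mathcal C(DN^2).$$ -/

import Mathlib

open scoped nonZeroDivisors NumberField MatrixGroups

namespace GammaForms

/-! ### Orders in a quadratic field and their ideal class groups -/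

/-- The order `ℤ + f 𝓞_K` of conductor `f` in a (quadratic) number field `K`. -/
def orderOfConductor (K : Type*) [Field K] [NumberField K] (f : ℕ) : Subring K where
  carrier := {x | ∃ (a : ℤ) (β : 𝓞 K), x = (a : K) + (f : K) * (β : K)}
  zero_mem' := ⟨0, 0, by simp⟩
  one_mem' := ⟨1, 0, by simp⟩
  add_mem' := by
    rintro _ _ ⟨a, β, rfl⟩ ⟨b, γ, rfl⟩
    exact ⟨a + b, β + γ, by push_cast; ring⟩
  neg_mem' := by
    rintro _ ⟨a, β, rfl⟩
    exact ⟨-a, -β, by push_cast; ring⟩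
  mul_mem' := by
    rintro _ _ ⟨a, β, rfl⟩ ⟨b, γ, rfl⟩
    exact ⟨a * b, (a : 𝓞 K) * γ + (b : 𝓞 K) * β + (f : 𝓞 K) * β * γ, by simp; ring⟩

section Ideals

variable {K : Type*} [Field K] (O : Subring K)

/-- The group of invertible fractional `O`-ideals in `K`. For the orders of a quadratic field these
are exactly the proper fractional ideals, see `isUnit_iff_isProper` below. -/
abbrev IdealGroup : Type _ := (FractionalIdeal O⁰ K)ˣ

variable {O} in
/-- A fractional `O`-ideal `I` is proper if `O = {x ∈ K | x I ⊆ I}`. -/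
def IsProper (I : FractionalIdeal O⁰ K) : Prop :=
  ∀ x : K, x ∈ O ↔ ∀ y ∈ I, x * y ∈ I

variable {O} in
/-- An `O`-ideal `𝔞` is relatively prime to `N` if `𝔞 + N O = O`. -/
def IsPrimeTo (𝔞 : Ideal O) (N : ℕ) : Prop :=
  𝔞 ⊔ Ideal.span {(N : O)} = ⊤

/-- `I(O, N)`: the group generated by the proper `O`-ideals relatively prime to `N`. -/
def idealsPrimeTo (N : ℕ) : Subgroup (IdealGroup O) :=
  Subgroup.closure {u | ∃ 𝔞 : Ideal O, (u : FractionalIdeal O⁰ K) = 𝔞 ∧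
    IsProper (𝔞 : FractionalIdeal O⁰ K) ∧ IsPrimeTo 𝔞 N}

/-- `P(O, N)`: the group generated by the principal `O`-ideals relatively prime to `N`. -/
def principalPrimeTo (N : ℕ) : Subgroup (IdealGroup O) :=
  Subgroup.closure {u | ∃ α : O,
    (u : FractionalIdeal O⁰ K) = (Ideal.span {α} : Ideal O) ∧ IsPrimeTo (Ideal.span {α}) N}

/-- `P₀(O, N)`: the group generated by the principal ideals `α O` with `α ∈ O` and
`α ≡ a (mod N O)` for some integer `a` relatively prime to `N`. -/
def principalCongr (N : ℕ) : Subgroup (IdealGroup O) :=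
  Subgroup.closure {u | ∃ (α : O) (a : ℤ),
    (u : FractionalIdeal O⁰ K) = (Ideal.span {α} : Ideal O) ∧
    IsCoprime a (N : ℤ) ∧ α - (a : O) ∈ Ideal.span {(N : O)}}

/-- `C(O, N) = I(O, N) / P(O, N)`. -/
abbrev IdealClassGroupPrimeTo (N : ℕ) : Type _ :=
  idealsPrimeTo O N ⧸ (principalPrimeTo O N).subgroupOf (idealsPrimeTo O N)

/-- `C₀(O, N) = I(O, N) / P₀(O, N)`. -/
abbrev IdealClassGroupCongr (N : ℕ) : Type _ :=
  idealsPrimeTo O N ⧸ (principalCongr O N).subgroupOf (idealsPrimeTo O N)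

/-- `C(O) = C(O, 1)`, the ideal class group of `O`. -/
abbrev IdealClassGroup : Type _ := IdealClassGroupPrimeTo O 1

variable {O}

theorem isProper_of_isUnit {I : FractionalIdeal O⁰ K} (h : IsUnit I) : IsProper I := by
  intro x
  constructor
  · intro hx y hy
    exact (I : Submodule O K).smul_mem (⟨x, hx⟩ : O) hy
  · intro hx
    obtain ⟨J, hJ⟩ := h.exists_right_inv
    have key : ∀ z ∈ I * J, x * z ∈ I * J := by
      intro z hz
      refine FractionalIdeal.mul_induction_on hz ?_ ?_
      · intro i hi j hj
        rw [← mul_assoc]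
        exact FractionalIdeal.mul_mem_mul (hx i hi) hj
      · intro a b ha hb
        rw [mul_add]
        exact (↑(I * J) : Submodule O K).add_mem ha hb
    have h1 := key 1 (by rw [hJ]; exact FractionalIdeal.one_mem_one _)
    rw [hJ, mul_one, FractionalIdeal.mem_one_iff] at h1
    obtain ⟨x', rfl⟩ := h1
    exact x'.2

theorem add_mem_fractionalIdeal (I : FractionalIdeal O⁰ K) (x y : K) (hx : x ∈ I) (hy : y ∈ I) :
    x + y ∈ I :=
  (I : Submodule O K).add_mem hx hy

theorem intCast_mul_mem (I : FractionalIdeal O⁰ K) (n : ℤ) (x : K) (hx : x ∈ I) :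
    (n : K) * x ∈ I := by
  rw [← zsmul_eq_mul]
  exact (I : Submodule O K).toAddSubgroup.zsmul_mem hx n

theorem principalPrimeTo_le (N : ℕ) : principalPrimeTo O N ≤ idealsPrimeTo O N := by
  refine Subgroup.closure_mono ?_
  rintro u ⟨α, h, hα⟩
  exact ⟨_, h, h ▸ isProper_of_isUnit u.isUnit, hα⟩

theorem principalCongr_le (N : ℕ) : principalCongr O N ≤ principalPrimeTo O N := by
  refine Subgroup.closure_mono ?_
  rintro u ⟨α, a, h, ⟨r, s, hrs⟩, hα⟩
  refine ⟨α, h, ?_⟩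
  rw [IsPrimeTo, Ideal.eq_top_iff_one]
  obtain ⟨t, ht⟩ := Ideal.mem_span_singleton'.1 hα
  have hrs' : (r : O) * a + s * N = 1 := by exact_mod_cast congrArg (Int.cast : ℤ → O) hrs
  have : (1 : O) = r * α + (s - r * t) * N := by
    rw [← hrs']
    linear_combination (r : O) * ht
  rw [this]
  exact add_mem (Ideal.mem_sup_left (Ideal.mul_mem_left _ _ (Ideal.mem_span_singleton_self _)))
    (Ideal.mem_sup_right (Ideal.mul_mem_left _ _ (Ideal.mem_span_singleton_self _)))

end Ideals

section Proper

variable {K : Type*} [Field K] [NumberField K] [Algebra.IsQuadraticExtension ℚ K]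

theorem exists_primitive_relation (τ : K) : ∃ a b c u v w : ℤ,
    (a : K) * τ ^ 2 + b * τ + c = 0 ∧ u * a + v * b + w * c = 1 := by
  have h1 : ¬ LinearIndependent ℤ ![τ ^ 2, τ, (1 : K)] := by
    rw [LinearIndependent.iff_fractionRing ℤ ℚ]
    intro h
    have := h.fintype_card_le_finrank
    rw [Algebra.IsQuadraticExtension.finrank_eq_two] at this
    simp at this
  obtain ⟨g, hg, i, hi⟩ := Fintype.not_linearIndependent_iff.1 h1
  simp only [Fin.sum_univ_three, zsmul_eq_mul] at hg
  simp at hg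
  obtain ⟨d, hd⟩ := (IsPrincipalIdealRing.principal (Ideal.span {g 0, g 1, g 2})).principal
  have hmem : ∀ j, g j ∈ Ideal.span {g 0, g 1, g 2} := by
    intro j
    apply Ideal.subset_span
    fin_cases j <;> simp
  have hdvd : ∀ j, d ∣ g j := by
    intro j
    have := hmem j
    rw [hd] at this
    exact Ideal.mem_span_singleton.1 this
  have hd0 : d ≠ 0 := by
    rintro rfl
    exact hi (zero_dvd_iff.1 (hdvd i))
  have hdm : d ∈ Ideal.span {g 0, g 1, g 2} := by
    rw [hd]; exact Ideal.mem_span_singleton_self d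
  obtain ⟨u, z, hz, huz⟩ := Ideal.mem_span_insert.1 hdm
  obtain ⟨v, w, hvw⟩ := Ideal.mem_span_pair.1 hz
  obtain ⟨a, ha⟩ := hdvd 0
  obtain ⟨b, hb⟩ := hdvd 1
  obtain ⟨c, hc⟩ := hdvd 2
  refine ⟨a, b, c, u, v, w, ?_, ?_⟩
  · have hdK : (d : K) ≠ 0 := by exact_mod_cast hd0
    apply mul_left_cancel₀ hdK
    rw [ha, hb, hc] at hg
    push_cast at hg
    linear_combination hg
  · apply mul_left_cancel₀ hd0
    rw [← hvw, ha, hb, hc] at huz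
    linear_combination -huz

theorem exists_two_generators {f : ℕ} (I : FractionalIdeal (orderOfConductor K f)⁰ K) :
    ∃ α ∈ I, ∃ β ∈ I, ∀ x ∈ I, ∃ m n : ℤ, x = m * α + n * β := by
  obtain ⟨d, hd, hdI⟩ := I.2
  have hd0 : (d : K) ≠ 0 := by
    simpa using nonZeroDivisors.ne_zero hd
  have hint : ∀ x ∈ I, ∃ y : 𝓞 K, (y : K) = d * x := by
    intro x hx
    obtain ⟨⟨z, a, β, hz⟩, hz'⟩ := hdI x hx
    refine ⟨a + f * β, ?_⟩
    have hz'' : z = (d : K) * x := hz'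
    rw [← hz'', hz]
    push_cast
    rfl
  have hzI : ∀ (n : ℤ) (x : K), x ∈ I → (n : K) * x ∈ I := intCast_mul_mem I
  have haddI : ∀ x y : K, x ∈ I → y ∈ I → x + y ∈ I := add_mem_fractionalIdeal I
  let S : Submodule ℤ (𝓞 K) :=
    { carrier := {y | ∃ x ∈ I, (y : K) = d * x}
      zero_mem' := ⟨0, I.zero_mem, by simp⟩
      add_mem' := by
        rintro y z ⟨x, hx, hy⟩ ⟨x', hx', hz⟩
        exact ⟨x + x', haddI _ _ hx hx', by
          rw [mul_add, ← hy, ← hz]; exact map_add (algebraMap (𝓞 K) K) y z⟩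
      smul_mem' := by
        rintro n y ⟨x, hx, hy⟩
        refine ⟨n * x, hzI _ _ hx, ?_⟩
        rw [mul_left_comm, ← hy, ← zsmul_eq_mul]
        exact map_zsmul (algebraMap (𝓞 K) K) n y }
  obtain ⟨n, ⟨B⟩⟩ := Submodule.nonempty_basis_of_pid (NumberField.RingOfIntegers.basis K) S
  have hn : n ≤ 2 := by
    have h1 : Module.finrank ℤ S = n := by simpa using Module.finrank_eq_card_basis B
    have h2 : Module.finrank ℤ S ≤ Module.finrank ℤ (𝓞 K) := Submodule.finrank_le S
    rw [NumberField.RingOfIntegers.rank, Algebra.IsQuadraticExtension.finrank_eq_two] at h2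
    omega
  have hspan : ∃ s t : S, ∀ z : S, ∃ m k : ℤ, z = m • s + k • t := by
    have hB := fun z => B.sum_repr z
    interval_cases n
    · exact ⟨0, 0, fun z => ⟨0, 0, by simpa using (hB z).symm⟩⟩
    · exact ⟨B 0, 0, fun z => ⟨B.repr z 0, 0, by simpa using (hB z).symm⟩⟩
    · exact ⟨B 0, B 1, fun z => ⟨B.repr z 0, B.repr z 1, by
        rw [← Fin.sum_univ_two (fun i => B.repr z i • B i)]; exact (hB z).symm⟩⟩
  obtain ⟨⟨s, α, hα, hs⟩, ⟨t, β, hβ, ht⟩, h⟩ := hspan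
  refine ⟨α, hα, β, hβ, fun x hx => ?_⟩
  obtain ⟨y, hy⟩ := hint x hx
  obtain ⟨m, k, hmk⟩ := h ⟨y, x, hx, hy⟩
  refine ⟨m, k, mul_left_cancel₀ hd0 ?_⟩
  have h3 : (algebraMap (𝓞 K) K) y = m * algebraMap (𝓞 K) K s + k * algebraMap (𝓞 K) K t := by
    simpa using congrArg (fun z : S => algebraMap (𝓞 K) K (z : 𝓞 K)) hmk
  change (algebraMap (𝓞 K) K) y = _ at hy
  change (algebraMap (𝓞 K) K) s = _ at hs
  change (algebraMap (𝓞 K) K) t = _ at ht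
  rw [hy, hs, ht] at h3
  linear_combination h3

/-- For the orders of a quadratic field, the proper fractional ideals are exactly the invertible
ones; in particular they form a group. -/
theorem isUnit_iff_isProper {f : ℕ} (I : FractionalIdeal (orderOfConductor K f)⁰ K) :
    IsUnit I ↔ IsProper I := by
  refine ⟨isProper_of_isUnit, fun hI => ?_⟩
  let O := orderOfConductor K f
  have hI0 : ∃ x ∈ I, x ≠ 0 := by
    by_contra! h0
    have hall : ∀ x : K, x ∈ O := fun x => (hI x).2 fun y hy => by
      rw [h0 y hy, mul_zero]; exact I.zero_mem
    obtain ⟨a, β, h⟩ := hall (1 / 2)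
    have hint : IsIntegral ℤ ((1 / 2 : ℚ)) := by
      have : IsIntegral ℤ (algebraMap ℚ K (1 / 2)) := by
        have e : algebraMap ℚ K (1 / 2) = (a : K) + (f : K) * (β : K) := by rw [← h]; simp
        rw [e]
        have h4 : IsIntegral ℤ (a : K) := isIntegral_algebraMap (R := ℤ) (x := a)
        have h5 : IsIntegral ℤ (f : K) := by
          simpa using isIntegral_algebraMap (R := ℤ) (A := K) (x := (f : ℤ))
        exact h4.add (h5.mul β.2)
      exact (isIntegral_algebraMap_iff (algebraMap ℚ K).injective).1 this
    obtain ⟨n, hn⟩ := IsIntegrallyClosed.isIntegral_iff.1 hint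
    have h2 : (n : ℚ) * 2 = 1 := by
      have : (n : ℚ) = 1 / 2 := by simpa using hn
      rw [this]; norm_num
    have h3 : n * 2 = 1 := by exact_mod_cast h2
    omega
  obtain ⟨α, hα, β, hβ, hαβ, hα0⟩ : ∃ α ∈ I, ∃ β ∈ I,
      (∀ x ∈ I, ∃ m n : ℤ, x = m * α + n * β) ∧ α ≠ 0 := by
    obtain ⟨α, hα, β, hβ, h⟩ := exists_two_generators I
    by_cases h0 : α = 0
    · refine ⟨β, hβ, α, hα, fun x hx => ?_, ?_⟩
      · obtain ⟨m, n, e⟩ := h x hx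
        exact ⟨n, m, by rw [e, add_comm]⟩
      · rintro rfl
        obtain ⟨x, hx, hx0⟩ := hI0
        obtain ⟨m, n, e⟩ := h x hx
        exact hx0 (by rw [e, h0]; simp)
    · exact ⟨α, hα, β, hβ, h, h0⟩
  obtain ⟨a, b, c, u, v, w, hτ, huvw⟩ := exists_primitive_relation (β / α)
  have hrel : (a : K) * β ^ 2 + b * α * β + c * α ^ 2 = 0 := by
    field_simp at hτ
    linear_combination hτ
  have hzI : ∀ (n : ℤ) (x : K), x ∈ I → (n : K) * x ∈ I := intCast_mul_mem I
  have haddI : ∀ x y : K, x ∈ I → y ∈ I → x + y ∈ I := add_mem_fractionalIdeal I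
  have hz : ∀ n : ℤ, (n : K) ∈ O := fun n => intCast_mem O n
  have hω : (a : K) * (β / α) ∈ O := by
    refine (hI _).2 fun y hy => ?_
    obtain ⟨m, n, rfl⟩ := hαβ y hy
    have : (a : K) * (β / α) * (m * α + n * β)
        = ((a * m - b * n : ℤ) : K) * β + ((-c * n : ℤ) : K) * α := by
      push_cast
      field_simp
      linear_combination (n : K) * hrel
    rw [this]
    exact haddI _ _ (hzI _ _ hβ) (hzI _ _ hα)
  -- the inverse ideal, generated by `a / α` and `(b + a β / α) / α`
  have hprod : ∀ x ∈ I, ∀ y ∈ Submodule.span O {(a : K) / α, (b + a * (β / α)) / α},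
      x * y ∈ O := by
    intro x hx y hy
    obtain ⟨m, n, rfl⟩ := hαβ x hx
    obtain ⟨r, s, rfl⟩ := Submodule.mem_span_pair.1 hy
    have : (m * α + n * β) * (r • ((a : K) / α) + s • ((b + a * (β / α)) / α))
        = (r : K) * (((m * a : ℤ) : K) + n * (a * (β / α)))
          + (s : K) * (((m * b - n * c : ℤ) : K) + m * (a * (β / α))) := by
      simp only [Subring.smul_def, smul_eq_mul]
      push_cast
      field_simp
      linear_combination (s : K) * n * hrel
    rw [this]
    exact O.add_mem (O.mul_mem r.2 (O.add_mem (hz _) (O.mul_mem (hz _) hω)))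
      (O.mul_mem s.2 (O.add_mem (hz _) (O.mul_mem (hz _) hω)))
  have hfrac : IsFractional O⁰ (Submodule.span O {(a : K) / α, (b + a * (β / α)) / α}) := by
    obtain ⟨d, hd, hdI⟩ := I.2
    obtain ⟨e, he⟩ := hdI α hα
    have he' : (e : K) = (d : K) * α := he
    have hd0 : (d : K) ≠ 0 := by simpa using nonZeroDivisors.ne_zero hd
    refine ⟨e, mem_nonZeroDivisors_of_ne_zero ?_, fun y hy => ?_⟩
    · rintro rfl
      exact mul_ne_zero hd0 hα0 (by rw [← he']; simp)
    · refine ⟨d * ⟨α * y, hprod α hα y hy⟩, ?_⟩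
      change (d : K) * (α * y) = (e : K) * y
      rw [he', mul_assoc]
  let J : FractionalIdeal O⁰ K := ⟨_, hfrac⟩
  refine IsUnit.of_mul_eq_one J (le_antisymm ?_ ?_)
  · rw [FractionalIdeal.mul_le]
    intro x hx y hy
    rw [FractionalIdeal.mem_one_iff]
    exact ⟨⟨x * y, hprod x hx y hy⟩, rfl⟩
  · have hJ1 : (a : K) / α ∈ J := Submodule.subset_span (by simp)
    have hJ2 : (b + a * (β / α)) / α ∈ J := Submodule.subset_span (by simp)
    have h1 : (1 : K) ∈ I * J := by
      have e : (1 : K) = ((u : K) * α - v * β) * (a / α)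
          + ((v : K) * α - w * β) * ((b + a * (β / α)) / α) := by
        have h' : (u : K) * a + v * b + w * c = 1 := by exact_mod_cast huvw
        rw [← h']
        field_simp
        linear_combination (w : K) * hrel
      rw [e]
      refine (↑(I * J) : Submodule O K).add_mem
        (FractionalIdeal.mul_mem_mul ?_ hJ1) (FractionalIdeal.mul_mem_mul ?_ hJ2)
      · rw [sub_eq_add_neg, ← neg_mul]
        exact haddI _ _ (hzI _ _ hα) (by simpa using hzI (-v) _ hβ)
      · rw [sub_eq_add_neg, ← neg_mul]
        exact haddI _ _ (hzI _ _ hα) (by simpa using hzI (-w) _ hβ)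
    intro x hx
    obtain ⟨x', rfl⟩ := (FractionalIdeal.mem_one_iff _).1 hx
    have h2 := (↑(I * J) : Submodule O K).smul_mem x' h1
    rwa [Algebra.smul_def, mul_one] at h2

end Proper

/-! ### Binary quadratic forms and `Γ₀(N)`-form class groups -/

/-- The integral binary quadratic form `a x² + b x y + c y²`. -/
@[ext]
structure BinForm where
  /-- the coefficient of `x²` -/
  a : ℤ
  /-- the coefficient of `x y` -/
  b : ℤ
  /-- the coefficient of `y²` -/
  c : ℤ

namespace BinForm

/-- The value `Q(x, y)`. -/
def eval (Q : BinForm) (x y : ℤ) : ℤ := Q.a * x ^ 2 + Q.b * x * y + Q.c * y ^ 2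

/-- The discriminant `b² - 4 a c`. -/
def disc (Q : BinForm) : ℤ := Q.b ^ 2 - 4 * Q.a * Q.c

/-- The coefficients have no common divisor other than `± 1`. -/
def IsPrimitive (Q : BinForm) : Prop := Int.gcd Q.a (Int.gcd Q.b Q.c) = 1

/-- `Q` takes positive values away from the origin. -/
def IsPosDef (Q : BinForm) : Prop := ∀ x y : ℤ, (x, y) ≠ (0, 0) → 0 < Q.eval x y

/-- `Q'(x, y) = Q(p x + q y, r x + s y)` for some matrix `(p q; r s)` in `Γ`. -/
def GammaEquiv (Γ : Subgroup SL(2, ℤ)) (Q Q' : BinForm) : Prop :=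
  ∃ γ ∈ Γ, ∀ x y : ℤ, Q'.eval x y = Q.eval (γ 0 0 * x + γ 0 1 * y) (γ 1 0 * x + γ 1 1 * y)

theorem gammaEquiv_equivalence (Γ : Subgroup SL(2, ℤ)) : Equivalence (GammaEquiv Γ) where
  refl Q := ⟨1, Γ.one_mem, fun x y => by simp⟩
  symm := by
    rintro Q Q' ⟨γ, hγ, h⟩
    refine ⟨γ⁻¹, Γ.inv_mem hγ, fun x y => ?_⟩
    have hdet := γ.det_coe
    rw [Matrix.det_fin_two] at hdet
    rw [h, Matrix.SpecialLinearGroup.SL2_inv_expl]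
    simp only [Matrix.cons_val_zero, Matrix.cons_val_one, Matrix.cons_val']
    congr 1
    · linear_combination (-x) * hdet
    · linear_combination (-y) * hdet
  trans := by
    rintro Q Q' Q'' ⟨γ, hγ, h⟩ ⟨δ, hδ, h'⟩
    refine ⟨γ * δ, Γ.mul_mem hγ hδ, fun x y => ?_⟩
    rw [h', h]
    simp only [Matrix.SpecialLinearGroup.coe_mul, Matrix.mul_apply, Fin.sum_univ_two]
    congr 1 <;> ring

end BinForm

/-- The primitive positive definite forms `a x² + b x y + c y²` of discriminant `D` such that `a` is
relatively prime to `N`. -/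
structure QF (D : ℤ) (N : ℕ) extends BinForm where
  isPrimitive : toBinForm.IsPrimitive
  isPosDef : toBinForm.IsPosDef
  disc_eq : toBinForm.disc = D
  coprime : IsCoprime a (N : ℤ)

/-- `Γ₀(N)`-equivalence on the forms in `QF D N`. -/
def QF.setoid (D : ℤ) (N : ℕ) : Setoid (QF D N) where
  r Q Q' := BinForm.GammaEquiv (CongruenceSubgroup.Gamma0 N) Q.toBinForm Q'.toBinForm
  iseqv := (BinForm.gammaEquiv_equivalence _).comap QF.toBinForm

/-- The set `C(D, Γ₀(N))` of `Γ₀(N)`-equivalence classes. -/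
def FormClass (D : ℤ) (N : ℕ) : Type := Quotient (QF.setoid D N)

/-- The class of a form in `C(D, Γ₀(N))`. -/
def FormClass.mk {D : ℤ} {N : ℕ} (Q : QF D N) : FormClass D N := Quotient.mk (QF.setoid D N) Q

/-- `Q''` is a Dirichlet composition of `Q = a x² + b x y + c y²` and `Q' = a' x² + b' x y + c' y²`:
one has `gcd (a, a', (b + b') / 2) = 1` (here `b` and `b'` have the parity of `D`), and
`Q'' = a a' x² + B x y + (B² - D) / (4 a a') y²` where `B ≡ b (mod 2 a)`, `B ≡ b' (mod 2 a')` and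
`B² ≡ D (mod 4 a a')`. -/
def IsDirichletComposition {D : ℤ} {N : ℕ} (Q Q' Q'' : QF D N) : Prop :=
  Int.gcd Q.a (Int.gcd Q'.a ((Q.b + Q'.b) / 2)) = 1 ∧
  ∃ B : ℤ, B ≡ Q.b [ZMOD 2 * Q.a] ∧ B ≡ Q'.b [ZMOD 2 * Q'.a] ∧
    B ^ 2 ≡ D [ZMOD 4 * Q.a * Q'.a] ∧
    Q''.a = Q.a * Q'.a ∧ Q''.b = B ∧ Q''.c = (B ^ 2 - D) / (4 * Q.a * Q'.a)

/-- The multiplication of a group structure on `C(D, Γ₀(N))` is the one induced by Dirichlet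
composition: `z = x y` if and only if `z` is represented by a Dirichlet composition of
representatives of `x` and `y`. This determines the group structure uniquely. -/
def IsDirichletGroup {D : ℤ} {N : ℕ} (G : CommGroup (FormClass D N)) : Prop :=
  ∀ x y z : FormClass D N, z = G.mul x y ↔ ∃ Q Q' Q'' : QF D N,
    FormClass.mk Q = x ∧ FormClass.mk Q' = y ∧ FormClass.mk Q'' = z ∧
    IsDirichletComposition Q Q' Q''

end GammaForms

namespace GammaForms

/-! ### Arithmetic of binary quadratic forms -/

/-! Part (2): `Q(x, y) ↦ Q(x, N y)` multiplies the discriminant by `N²`, and conjugation by `diag(1,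
N)` carries `Γ₀(N)` into `SL(2, ℤ)`. Because leading coefficients are prime to `N`, the induced map
of classes is injective (`QF.mk_eq_of_mk_scale_eq`) and surjective (`QF.exists_mk_scale_eq`), and it
respects Dirichlet composition (`QF.isDirichletComposition_scale`). So only level 1 needs a group
law. There a form with root `τ` in the upper half plane gives the lattice `ℤ + ℤ τ`: equivalent
forms are those with homothetic lattices, composition is multiplication of lattices
(`QF.lattice_eq_mul`), and the opposite form gives the inverse. The classes thus form a subgroup of
the invertible lattices modulo homothety, and the group axioms are inherited.

Part (1): let `O' ⊆ O` be the orders of conductors `N f` and `f`, so that `N O ⊆ O'`. Extension and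
contraction are inverse to each other on ideals prime to `N`, hence `I(O', N) ≅ I(O, N)`. Under this
isomorphism `P₀(O, N)` corresponds to `I(O', N) ∩ P(O', 1)` (`extendHom_mem_principalCongr_iff`),
since the elements of `O'` prime to `N` are the elements of `O` congruent modulo `N O` to an integer
prime to `N`. As every class of `O'` contains an ideal prime to `N`
(`exists_toPrincipalIdeal_mul_mem`), both quotients are quotients of `I(O', N)` with the same
kernel. -/

theorem isCoprime_natCast_of_prime {n : ℤ} {M : ℕ}
    (h : ∀ p : ℕ, p.Prime → p ∣ M → ¬ (p : ℤ) ∣ n) : IsCoprime n (M : ℤ) := by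
  rw [Int.isCoprime_iff_gcd_eq_one]
  by_contra hne
  obtain ⟨p, hp, hpd⟩ := Nat.exists_prime_and_dvd hne
  have h1 := Int.dvd_coe_gcd_iff.1 (Int.natCast_dvd_natCast.2 hpd)
  exact h p hp (Int.natCast_dvd_natCast.1 h1.2) h1.1

theorem not_dvd_of_isCoprime {n m : ℤ} (h : IsCoprime n m) {p : ℕ} (hp : p.Prime)
    (hm : (p : ℤ) ∣ m) : ¬ (p : ℤ) ∣ n := fun hn =>
  (Nat.prime_iff_prime_int.1 hp).not_isUnit (h.isUnit_of_dvd' hn hm)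

/-- The arguments are products of primes of `M`, chosen so that modulo each such prime exactly one
term survives: `a x²` if `p ∤ a`, `c y²` if `p ∣ a` and `p ∤ c`, and `b x y` if `p` divides both `a`
and `c`. -/
theorem exists_isCoprime_value {a b c : ℤ}
    (h : ∀ p : ℕ, p.Prime → (p : ℤ) ∣ a → (p : ℤ) ∣ b → ¬ (p : ℤ) ∣ c) {M : ℕ} (hM : M ≠ 0) :
    ∃ x y : ℤ, IsCoprime x y ∧ IsCoprime (a * x ^ 2 + b * x * y + c * y ^ 2) (M : ℤ) := by
  classical
  let X : Finset ℕ := M.primeFactors.filter fun p => (p : ℤ) ∣ a ∧ ¬ (p : ℤ) ∣ c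
  let Y : Finset ℕ := M.primeFactors.filter fun p => ¬ (p : ℤ) ∣ a
  have key : ∀ (S : Finset ℕ), S ⊆ M.primeFactors → ∀ p : ℕ, p.Prime →
      ((p : ℤ) ∣ ((∏ q ∈ S, q : ℕ) : ℤ) ↔ p ∈ S) := by
    intro S hS p hp
    rw [Int.natCast_dvd_natCast]
    refine ⟨fun hd => ?_, fun hd => Finset.dvd_prod_of_mem _ hd⟩
    obtain ⟨q, hq, hpq⟩ := (hp.prime.dvd_finsetProd_iff _).1 hd
    rwa [(Nat.prime_dvd_prime_iff_eq hp (Nat.prime_of_mem_primeFactors (hS hq))).1 hpq]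
  have hX := key X (Finset.filter_subset _ _)
  have hY := key Y (Finset.filter_subset _ _)
  refine ⟨(∏ q ∈ X, q : ℕ), (∏ q ∈ Y, q : ℕ), ?_, ?_⟩
  · refine isCoprime_natCast_of_prime fun p hp hpy hpx => ?_
    have h1 := (hX p hp).1 hpx
    have h2 := (hY p hp).1 (Int.natCast_dvd_natCast.2 hpy)
    exact (Finset.mem_filter.1 h2).2 (Finset.mem_filter.1 h1).2.1
  · refine isCoprime_natCast_of_prime fun p hp hpM hpv => ?_
    have hmem : p ∈ M.primeFactors := Nat.mem_primeFactors.2 ⟨hp, hpM, hM⟩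
    have hpX := hX p hp
    have hpY := hY p hp
    simp only [X, Y, Finset.mem_filter, hmem, true_and] at hpX hpY
    generalize ((∏ q ∈ X, q : ℕ) : ℤ) = x at *
    generalize ((∏ q ∈ Y, q : ℕ) : ℤ) = y at *
    have hpi := Nat.prime_iff_prime_int.1 hp
    by_cases ha : (p : ℤ) ∣ a
    · have hy : ¬ (p : ℤ) ∣ y := fun hy => hpY.1 hy ha
      by_cases hc : (p : ℤ) ∣ c
      · have hx : ¬ (p : ℤ) ∣ x := fun hx => (hpX.1 hx).2 hc
        have : (p : ℤ) ∣ b * x * y := by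
          have e : b * x * y = (a * x ^ 2 + b * x * y + c * y ^ 2) - a * x ^ 2 - c * y ^ 2 := by
            ring
          rw [e]
          exact dvd_sub (dvd_sub hpv (ha.mul_right _)) (hc.mul_right _)
        rcases hpi.dvd_mul.1 this with h1 | h1
        · rcases hpi.dvd_mul.1 h1 with h2 | h2
          · exact h p hp ha h2 hc
          · exact hx h2
        · exact hy h1
      · have hx : (p : ℤ) ∣ x := hpX.2 ⟨ha, hc⟩
        have : (p : ℤ) ∣ c * y ^ 2 := by
          have e : c * y ^ 2 = (a * x ^ 2 + b * x * y + c * y ^ 2) - x * (a * x + b * y) := by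
            ring
          rw [e]
          exact dvd_sub hpv (hx.mul_right _)
        rcases hpi.dvd_mul.1 this with h1 | h1
        · exact hc h1
        · exact hy (hpi.dvd_of_dvd_pow h1)
    · have hy : (p : ℤ) ∣ y := hpY.2 ha
      have hx : ¬ (p : ℤ) ∣ x := fun hx => ha (hpX.1 hx).1
      have : (p : ℤ) ∣ a * x ^ 2 := by
        have e : a * x ^ 2 = (a * x ^ 2 + b * x * y + c * y ^ 2) - y * (b * x + c * y) := by
          ring
        rw [e]
        exact dvd_sub hpv (hy.mul_right _)
      rcases hpi.dvd_mul.1 this with h1 | h1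
      · exact ha h1
      · exact hx (hpi.dvd_of_dvd_pow h1)

namespace BinForm

theorem isPrimitive_iff {Q : BinForm} : Q.IsPrimitive ↔
    ∀ p : ℕ, p.Prime → (p : ℤ) ∣ Q.a → (p : ℤ) ∣ Q.b → ¬ (p : ℤ) ∣ Q.c := by
  constructor
  · intro h p hp ha hb hc
    have := Int.dvd_coe_gcd ha (Int.dvd_coe_gcd hb hc)
    rw [show Int.gcd Q.a (Int.gcd Q.b Q.c) = 1 from h] at this
    exact hp.one_lt.ne' (Nat.dvd_one.1 (Int.natCast_dvd_natCast.1 this))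
  · intro h
    by_contra hne
    obtain ⟨p, hp, hpd⟩ := Nat.exists_prime_and_dvd hne
    have h1 := Int.dvd_coe_gcd_iff.1 (Int.natCast_dvd_natCast.2 hpd)
    have h2 := Int.dvd_coe_gcd_iff.1 h1.2
    exact h p hp h1.1 h2.1 h2.2

theorem IsPrimitive.exists_bezout {Q : BinForm} (h : Q.IsPrimitive) :
    ∃ u v w : ℤ, u * Q.a + v * Q.b + w * Q.c = 1 := by
  have h1 := Int.gcd_eq_gcd_ab Q.a (Int.gcd Q.b Q.c)
  have h2 := Int.gcd_eq_gcd_ab Q.b Q.c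
  rw [show Int.gcd Q.a (Int.gcd Q.b Q.c) = 1 from h] at h1
  refine ⟨Int.gcdA Q.a (Int.gcd Q.b Q.c),
    Int.gcdB Q.a (Int.gcd Q.b Q.c) * Int.gcdA Q.b Q.c,
    Int.gcdB Q.a (Int.gcd Q.b Q.c) * Int.gcdB Q.b Q.c, ?_⟩
  push_cast at h1
  linear_combination -h1 - Int.gcdB Q.a (Int.gcd Q.b Q.c) * h2

theorem IsPosDef.a_pos {Q : BinForm} (h : Q.IsPosDef) : 0 < Q.a := by
  simpa [eval] using h 1 0 (by simp)

theorem isPosDef_of_a_pos {Q : BinForm} (ha : 0 < Q.a) (hD : Q.disc < 0) : Q.IsPosDef := by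
  intro x y hxy
  have e : 4 * Q.a * Q.eval x y = (2 * Q.a * x + Q.b * y) ^ 2 + -Q.disc * y ^ 2 := by
    simp only [eval, disc]; ring
  have hpos : 0 < 4 * Q.a * Q.eval x y := by
    rw [e]
    by_cases hy : y = 0
    · subst hy
      have hx : x ≠ 0 := fun hx => hxy (by rw [hx])
      have : 0 < (2 * Q.a * x) ^ 2 := by positivity
      simpa using this
    · have : 0 < -Q.disc := by omega
      positivity
  exact pos_of_mul_pos_right hpos (by positivity)

/-- The form `Q(p x + q y, r x + s y)`, where `γ = (p q; r s)`. -/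
def comp (Q : BinForm) (γ : SL(2, ℤ)) : BinForm where
  a := Q.a * γ 0 0 ^ 2 + Q.b * γ 0 0 * γ 1 0 + Q.c * γ 1 0 ^ 2
  b := 2 * Q.a * γ 0 0 * γ 0 1 + Q.b * (γ 0 0 * γ 1 1 + γ 0 1 * γ 1 0) + 2 * Q.c * γ 1 0 * γ 1 1
  c := Q.a * γ 0 1 ^ 2 + Q.b * γ 0 1 * γ 1 1 + Q.c * γ 1 1 ^ 2

theorem eval_comp (Q : BinForm) (γ : SL(2, ℤ)) (x y : ℤ) :
    (Q.comp γ).eval x y = Q.eval (γ 0 0 * x + γ 0 1 * y) (γ 1 0 * x + γ 1 1 * y) := by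
  simp only [eval, comp]; ring

theorem ext_eval {Q Q' : BinForm} (h : ∀ x y, Q.eval x y = Q'.eval x y) : Q = Q' := by
  have h1 := h 1 0
  have h2 := h 0 1
  have h3 := h 1 1
  simp only [eval] at h1 h2 h3
  ext <;> linarith

theorem gammaEquiv_iff {Γ : Subgroup SL(2, ℤ)} {Q Q' : BinForm} :
    GammaEquiv Γ Q Q' ↔ ∃ γ ∈ Γ, Q' = Q.comp γ := by
  refine exists_congr fun γ => and_congr_right fun _ => ⟨fun h => ext_eval fun x y => ?_, ?_⟩
  · rw [h, eval_comp]
  · rintro rfl x y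
    exact eval_comp _ _ _ _

theorem comp_comp (Q : BinForm) (γ δ : SL(2, ℤ)) : (Q.comp γ).comp δ = Q.comp (γ * δ) := by
  ext <;> simp only [comp, Matrix.SpecialLinearGroup.coe_mul, Matrix.mul_apply,
    Fin.sum_univ_two] <;> ring

theorem comp_one (Q : BinForm) : Q.comp 1 = Q := by
  ext <;> simp [comp]

theorem disc_comp (Q : BinForm) (γ : SL(2, ℤ)) : (Q.comp γ).disc = Q.disc := by
  have hdet := γ.det_coe
  rw [Matrix.det_fin_two] at hdet
  have : (Q.comp γ).disc = Q.disc * (γ 0 0 * γ 1 1 - γ 0 1 * γ 1 0) ^ 2 := by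
    simp only [comp, disc]; ring
  rw [this, hdet, one_pow, mul_one]

theorem IsPrimitive.comp {Q : BinForm} (h : Q.IsPrimitive) (γ : SL(2, ℤ)) :
    (Q.comp γ).IsPrimitive := by
  rw [isPrimitive_iff] at h ⊢
  intro p hp ha hb hc
  have key : ∀ (F : BinForm) (δ : SL(2, ℤ)), (p : ℤ) ∣ F.a → (p : ℤ) ∣ F.b → (p : ℤ) ∣ F.c →
      (p : ℤ) ∣ (F.comp δ).a ∧ (p : ℤ) ∣ (F.comp δ).b ∧ (p : ℤ) ∣ (F.comp δ).c := by
    rintro F δ ⟨a, ha⟩ ⟨b, hb⟩ ⟨c, hc⟩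
    simp only [BinForm.comp, ha, hb, hc]
    refine ⟨⟨a * δ 0 0 ^ 2 + b * δ 0 0 * δ 1 0 + c * δ 1 0 ^ 2, by ring⟩,
      ⟨2 * a * δ 0 0 * δ 0 1 + b * (δ 0 0 * δ 1 1 + δ 0 1 * δ 1 0) + 2 * c * δ 1 0 * δ 1 1,
        by ring⟩, ⟨a * δ 0 1 ^ 2 + b * δ 0 1 * δ 1 1 + c * δ 1 1 ^ 2, by ring⟩⟩
  have h1 := key (Q.comp γ) γ⁻¹ ha hb hc
  rw [comp_comp, mul_inv_cancel, comp_one] at h1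
  exact h p hp h1.1 h1.2.1 h1.2.2

theorem IsPosDef.comp_a_pos {Q : BinForm} (h : Q.IsPosDef) (γ : SL(2, ℤ)) :
    0 < (Q.comp γ).a := by
  have h1 : (Q.comp γ).a = Q.eval (γ 0 0) (γ 1 0) := by simp only [comp, eval]
  rw [h1]
  refine h _ _ fun h0 => ?_
  have hdet := γ.det_coe
  rw [Matrix.det_fin_two, (Prod.mk.inj h0).1, (Prod.mk.inj h0).2] at hdet
  simp at hdet

theorem disc_dvd (Q : BinForm) : (2 : ℤ) ∣ Q.b + Q.disc := by
  have h : Q.b + Q.disc = Q.b * (Q.b + 1) - 2 * (2 * Q.a * Q.c) := by simp only [disc]; ring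
  rw [h]
  exact dvd_sub (Int.even_mul_succ_self Q.b).two_dvd (dvd_mul_right _ _)

end BinForm

namespace QF

variable {D : ℤ} {N : ℕ}

theorem a_pos (Q : QF D N) : 0 < Q.a := Q.isPosDef.a_pos

theorem disc_eq' (Q : QF D N) : Q.b ^ 2 - 4 * Q.a * Q.c = D := Q.disc_eq

/-- The form `Q(p x + q y, r x + s y)` as an element of `QF D N`, provided that its leading
coefficient is relatively prime to `N`. -/
def comp (hD : D < 0) (Q : QF D N) (γ : SL(2, ℤ))
    (h : IsCoprime (Q.toBinForm.comp γ).a (N : ℤ)) : QF D N where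
  toBinForm := Q.toBinForm.comp γ
  isPrimitive := Q.isPrimitive.comp γ
  isPosDef := BinForm.isPosDef_of_a_pos (Q.isPosDef.comp_a_pos γ)
    (by rw [BinForm.disc_comp, Q.disc_eq]; exact hD)
  disc_eq := by rw [BinForm.disc_comp, Q.disc_eq]
  coprime := h

end QF

/-! ### Representatives of form classes and existence of Dirichlet compositions. -/

theorem FormClass.mk_eq_mk {D : ℤ} {N : ℕ} {Q Q' : QF D N} :
    FormClass.mk Q = FormClass.mk Q' ↔
      ∃ γ ∈ CongruenceSubgroup.Gamma0 N, Q'.toBinForm = Q.toBinForm.comp γ :=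
  Quotient.eq.trans BinForm.gammaEquiv_iff

theorem FormClass.exists_rep {D : ℤ} {N : ℕ} (x : FormClass D N) : ∃ Q : QF D N,
    FormClass.mk Q = x := Quotient.exists_rep x

theorem mem_Gamma0_iff_dvd {N : ℕ} {γ : SL(2, ℤ)} :
    γ ∈ CongruenceSubgroup.Gamma0 N ↔ (N : ℤ) ∣ γ 1 0 := by
  rw [CongruenceSubgroup.Gamma0_mem, ZMod.intCast_zmod_eq_zero_iff_dvd]

/-- The coefficients of `Q(x, N y)` have no common prime divisor. -/
theorem QF.not_dvd_scaled {D : ℤ} {N : ℕ} (Q : QF D N) (p : ℕ) (hp : p.Prime)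
    (ha : (p : ℤ) ∣ Q.a) (hb : (p : ℤ) ∣ Q.b * N) : ¬ (p : ℤ) ∣ Q.c * N ^ 2 := by
  intro hc
  have hpi := Nat.prime_iff_prime_int.1 hp
  have hN : ¬ (p : ℤ) ∣ N := not_dvd_of_isCoprime Q.coprime.symm hp ha
  refine BinForm.isPrimitive_iff.1 Q.isPrimitive p hp ha ?_ ?_
  · exact (hpi.dvd_mul.1 hb).resolve_right hN
  · exact (hpi.dvd_mul.1 hc).resolve_right fun h => hN (hpi.dvd_of_dvd_pow h)

/-- Every class contains a form whose leading coefficient is relatively prime to `M`. -/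
theorem FormClass.exists_rep_isCoprime {D : ℤ} {N : ℕ} (hD : D < 0) (hN : 0 < N)
    (x : FormClass D N) {M : ℕ} (hM : M ≠ 0) :
    ∃ Q : QF D N, FormClass.mk Q = x ∧ IsCoprime Q.a (M : ℤ) := by
  obtain ⟨Q, rfl⟩ := x.exists_rep
  -- The value is taken on `Q(x, N y)`, so that the column `(p, N r)` completes to a matrix of
  -- `Γ₀(N)`. It is primitive because the value is prime to `N` and congruent to `a p²` modulo `N`.
  obtain ⟨p, r, hpr, hv⟩ := exists_isCoprime_value Q.not_dvd_scaled (mul_ne_zero hM hN.ne')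
  push_cast at hv
  have hvM := hv.of_mul_right_left
  have hvN := hv.of_mul_right_right
  have hpN : IsCoprime p (N : ℤ) := by
    refine isCoprime_natCast_of_prime fun l hl hlN hlp => ?_
    have hlN' : (l : ℤ) ∣ N := Int.natCast_dvd_natCast.2 hlN
    refine not_dvd_of_isCoprime hvN hl hlN' ?_
    have e : Q.a * p ^ 2 + Q.b * N * p * r + Q.c * N ^ 2 * r ^ 2
        = p * (Q.a * p) + N * (Q.b * p * r + Q.c * N * r ^ 2) := by ring
    rw [e]
    exact dvd_add (hlp.mul_right _) (hlN'.mul_right _)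
  obtain ⟨γ, h0, h1⟩ := (hpN.mul_right hpr).exists_SL2_col 0
  have e : (Q.toBinForm.comp γ).a
      = Q.a * p ^ 2 + Q.b * N * p * r + Q.c * N ^ 2 * r ^ 2 := by
    simp only [BinForm.comp, h0, h1]; ring
  rw [← e] at hvN hvM
  refine ⟨Q.comp hD γ hvN, (FormClass.mk_eq_mk.2 ⟨γ, ?_, rfl⟩).symm, hvM⟩
  rw [mem_Gamma0_iff_dvd, h1]
  exact dvd_mul_right _ _

/-- Two forms with relatively prime leading coefficients have a Dirichlet composition. -/
theorem exists_isDirichletComposition_of_isCoprime {D : ℤ} {N : ℕ} (hD : D < 0) (Q Q' : QF D N)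
    (h : IsCoprime Q.a Q'.a) : ∃ Q'' : QF D N, IsDirichletComposition Q Q' Q'' := by
  obtain ⟨u, v, huv⟩ := h
  obtain ⟨t, ht⟩ : (2 : ℤ) ∣ Q'.b - Q.b := by
    have h1 := Q.toBinForm.disc_dvd
    have h2 := Q'.toBinForm.disc_dvd
    rw [Q.disc_eq] at h1
    rw [Q'.disc_eq] at h2
    have := dvd_sub h2 h1
    simpa using this
  -- Chinese remainder: from `u a + v a' = 1` and `b' - b = 2 t` follows `b + 2 a u t = b' - 2 a' v
  -- t`.
  obtain ⟨B, k, k', hk, hk'⟩ : ∃ B k k' : ℤ, B = Q.b + 2 * Q.a * k ∧ B = Q'.b + 2 * Q'.a * k' :=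
    ⟨Q.b + 2 * Q.a * (u * t), u * t, -(v * t), rfl, by linear_combination 2 * t * huv - ht⟩
  have hQ := Q.disc_eq'
  have hQ' := Q'.disc_eq'
  have ha := Q.a_pos
  have ha' := Q'.a_pos
  have e1 : B ^ 2 - D = 4 * Q.a * (Q.c + Q.b * k + Q.a * k ^ 2) := by
    rw [hk]; linear_combination hQ
  have e2 : B ^ 2 - D = 4 * Q'.a * (Q'.c + Q'.b * k' + Q'.a * k' ^ 2) := by
    rw [hk']; linear_combination hQ'
  obtain ⟨C, hC⟩ : Q'.a ∣ Q.c + Q.b * k + Q.a * k ^ 2 := by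
    have : Q'.a ∣ Q.a * (Q.c + Q.b * k + Q.a * k ^ 2) :=
      ⟨Q'.c + Q'.b * k' + Q'.a * k' ^ 2, by linarith⟩
    exact IsCoprime.dvd_of_dvd_mul_left ⟨v, u, by linear_combination huv⟩ this
  have hBC : B ^ 2 - D = 4 * Q.a * Q'.a * C := by rw [e1, hC]; ring
  have hC' : Q'.c + Q'.b * k' + Q'.a * k' ^ 2 = Q.a * C := by
    have : Q'.a * (Q'.c + Q'.b * k' + Q'.a * k' ^ 2) = Q'.a * (Q.a * C) := by
      linarith
    exact mul_left_cancel₀ ha'.ne' this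
  have hdisc : B ^ 2 - 4 * (Q.a * Q'.a) * C = D := by linear_combination hBC
  refine ⟨⟨⟨Q.a * Q'.a, B, C⟩, ?_, ?_, hdisc, Q.coprime.mul_left Q'.coprime⟩, ?_, B,
    ?_, ?_, ?_, rfl, rfl, ?_⟩
  -- A prime dividing the three new coefficients divides `a` or `a'`, and then every coefficient of
  -- `Q` or of `Q'` respectively.
  · rw [BinForm.isPrimitive_iff]
    intro p hp h1 h2 h3
    simp only at h1 h2 h3
    rcases (Nat.prime_iff_prime_int.1 hp).dvd_mul.1 h1 with h4 | h4
    · have h5 : (p : ℤ) ∣ Q.b := by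
        rw [show Q.b = B - Q.a * (2 * k) by rw [hk]; ring]
        exact dvd_sub h2 (h4.mul_right _)
      refine BinForm.isPrimitive_iff.1 Q.isPrimitive p hp h4 h5 ?_
      rw [show Q.c = Q'.a * C - Q.b * k - Q.a * k ^ 2 by rw [← hC]; ring]
      exact dvd_sub (dvd_sub (h3.mul_left _) (h5.mul_right _)) (h4.mul_right _)
    · have h5 : (p : ℤ) ∣ Q'.b := by
        rw [show Q'.b = B - Q'.a * (2 * k') by rw [hk']; ring]
        exact dvd_sub h2 (h4.mul_right _)
      refine BinForm.isPrimitive_iff.1 Q'.isPrimitive p hp h4 h5 ?_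
      rw [show Q'.c = Q.a * C - Q'.b * k' - Q'.a * k' ^ 2 by rw [← hC']; ring]
      exact dvd_sub (dvd_sub (h3.mul_left _) (h5.mul_right _)) (h4.mul_right _)
  · refine BinForm.isPosDef_of_a_pos (mul_pos ha ha') ?_
    rw [BinForm.disc, hdisc]
    exact hD
  · have hcop : IsCoprime Q.a (Int.gcd Q'.a ((Q.b + Q'.b) / 2)) :=
      IsCoprime.of_isCoprime_of_dvd_right ⟨u, v, huv⟩ (Int.gcd_dvd_left _ _)
    exact Int.isCoprime_iff_gcd_eq_one.1 hcop
  · exact (Int.modEq_iff_dvd.2 ⟨-k, by rw [hk]; ring⟩)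
  · exact (Int.modEq_iff_dvd.2 ⟨-k', by rw [hk']; ring⟩)
  · exact (Int.modEq_iff_dvd.2 ⟨-C, by linear_combination -hBC⟩)
  · simp only
    rw [hBC, Int.mul_ediv_cancel_left]
    positivity

/-- Any two classes have representatives with a Dirichlet composition. -/
theorem FormClass.exists_isDirichletComposition {D : ℤ} {N : ℕ} (hD : D < 0) (hN : 0 < N)
    (x y : FormClass D N) : ∃ Q Q' Q'' : QF D N, FormClass.mk Q = x ∧ FormClass.mk Q' = y ∧
      IsDirichletComposition Q Q' Q'' := by
  obtain ⟨Q, hQ⟩ := x.exists_rep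
  obtain ⟨Q', hQ', h⟩ := y.exists_rep_isCoprime hD hN (M := Q.a.natAbs)
    (Int.natAbs_ne_zero.2 Q.a_pos.ne')
  have h' : IsCoprime Q.a Q'.a := by
    rw [Int.natAbs_of_nonneg Q.a_pos.le] at h
    exact h.symm
  obtain ⟨R, hR⟩ := exists_isDirichletComposition_of_isCoprime hD Q Q' h'
  exact ⟨Q, Q', R, hQ, hQ', hR⟩

/-- An injective map from the form classes to a commutative group that turns Dirichlet
composition into multiplication determines Dirichlet composition. -/
theorem FormClass.map_eq_mul_iff {D : ℤ} {N : ℕ} (hD : D < 0) (hN : 0 < N) {G : Type*} [Mul G]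
    (ψ : FormClass D N → G) (hψ : Function.Injective ψ)
    (hmul : ∀ Q Q' Q'' : QF D N, IsDirichletComposition Q Q' Q'' →
      ψ (mk Q'') = ψ (mk Q) * ψ (mk Q')) (x y z : FormClass D N) :
    ψ z = ψ x * ψ y ↔ ∃ Q Q' Q'' : QF D N, FormClass.mk Q = x ∧ FormClass.mk Q' = y ∧
      FormClass.mk Q'' = z ∧ IsDirichletComposition Q Q' Q'' := by
  constructor
  · intro h
    obtain ⟨Q, Q', Q'', rfl, rfl, hc⟩ := FormClass.exists_isDirichletComposition hD hN x y
    -- Any composition of any representatives will do: injectivity of `ψ` forces its class to be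
    -- `z`.
    exact ⟨Q, Q', Q'', rfl, rfl, hψ (by rw [h, hmul _ _ _ hc]), hc⟩
  · rintro ⟨Q, Q', Q'', rfl, rfl, rfl, hc⟩
    exact hmul _ _ _ hc

/-! ### From level `N` and discriminant `D` to level `1` and discriminant `D N²` -/

/-- The form `Q(x, N y)`. -/
def QF.scale {D : ℤ} {N : ℕ} (hD : D < 0) (hN : 0 < N) (Q : QF D N) :
    QF (D * (N : ℤ) ^ 2) 1 where
  a := Q.a
  b := Q.b * N
  c := Q.c * N ^ 2
  isPrimitive := BinForm.isPrimitive_iff.2 Q.not_dvd_scaled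
  isPosDef := by
    refine BinForm.isPosDef_of_a_pos Q.a_pos ?_
    have h : (Q.b * N) ^ 2 - 4 * Q.a * (Q.c * N ^ 2) = D * (N : ℤ) ^ 2 := by
      linear_combination (N : ℤ) ^ 2 * Q.disc_eq'
    rw [BinForm.disc, h]
    exact mul_neg_of_neg_of_pos hD (by positivity)
  disc_eq := by
    simp only [BinForm.disc]
    linear_combination (N : ℤ) ^ 2 * Q.disc_eq'
  coprime := by simpa using isCoprime_one_right

section Scale

variable {D : ℤ} {N : ℕ} (hD : D < 0) (hN : 0 < N)

/-- If `B` works for the original forms, `B * N` works for the scaled ones. The gcd condition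
survives because `Q.a` is prime to `N`. -/
theorem QF.isDirichletComposition_scale {Q Q' Q'' : QF D N}
    (h : IsDirichletComposition Q Q' Q'') :
    IsDirichletComposition (Q.scale hD hN) (Q'.scale hD hN) (Q''.scale hD hN) := by
  obtain ⟨hgcd, B, h1, h2, h3, ha, hb, hc⟩ := h
  have ha0 := Q.a_pos
  have ha0' := Q'.a_pos
  obtain ⟨t, ht⟩ : (2 : ℤ) ∣ Q.b + Q'.b := by
    have h1 := Q.toBinForm.disc_dvd
    have h2 := Q'.toBinForm.disc_dvd
    rw [Q.disc_eq] at h1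
    rw [Q'.disc_eq] at h2
    have := dvd_sub (dvd_add h1 h2) (dvd_mul_right 2 D)
    have e : Q.b + D + (Q'.b + D) - 2 * D = Q.b + Q'.b := by ring
    rwa [e] at this
  refine ⟨?_, B * N, ?_, ?_, ?_, ha, ?_, ?_⟩
  · have e : (Q.b * N + Q'.b * N) / 2 = t * N := by
      rw [← add_mul, ht, mul_assoc, Int.mul_ediv_cancel_left _ two_ne_zero]
    have e' : (Q.b + Q'.b) / 2 = t := by
      rw [ht, Int.mul_ediv_cancel_left _ two_ne_zero]
    change Int.gcd Q.a (Int.gcd Q'.a ((Q.b * N + Q'.b * N) / 2)) = 1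
    rw [e]
    rw [e'] at hgcd
    have hp : (⟨Q.a, Q'.a, t⟩ : BinForm).IsPrimitive := hgcd
    refine BinForm.isPrimitive_iff (Q := ⟨Q.a, Q'.a, t * N⟩).2 fun p hp' g1 g2 g3 => ?_
    refine BinForm.isPrimitive_iff.1 hp p hp' g1 g2 ?_
    exact ((Nat.prime_iff_prime_int.1 hp').dvd_mul.1 g3).resolve_right
      (not_dvd_of_isCoprime Q.coprime.symm hp' g1)
  · obtain ⟨k, hk⟩ := Int.modEq_iff_dvd.1 h1
    exact Int.modEq_iff_dvd.2 ⟨k * N, by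
      change Q.b * N - B * N = 2 * Q.a * (k * N); linear_combination (N : ℤ) * hk⟩
  · obtain ⟨k, hk⟩ := Int.modEq_iff_dvd.1 h2
    exact Int.modEq_iff_dvd.2 ⟨k * N, by
      change Q'.b * N - B * N = 2 * Q'.a * (k * N); linear_combination (N : ℤ) * hk⟩
  · obtain ⟨k, hk⟩ := Int.modEq_iff_dvd.1 h3
    exact Int.modEq_iff_dvd.2 ⟨k * N ^ 2, by
      change D * (N : ℤ) ^ 2 - (B * N) ^ 2 = 4 * Q.a * Q'.a * (k * N ^ 2)
      linear_combination (N : ℤ) ^ 2 * hk⟩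
  · change Q''.b * N = B * N
    rw [hb]
  · change Q''.c * N ^ 2 = ((B * N) ^ 2 - D * N ^ 2) / (4 * Q.a * Q'.a)
    obtain ⟨k, hk⟩ := Int.modEq_iff_dvd.1 h3
    have hk' : B ^ 2 - D = (4 * Q.a * Q'.a) * -k := by linear_combination -hk
    have hne : 4 * Q.a * Q'.a ≠ 0 := by positivity
    rw [hc, hk', show (B * N) ^ 2 - D * (N : ℤ) ^ 2 = (4 * Q.a * Q'.a) * (-k * N ^ 2) by
      linear_combination (N : ℤ) ^ 2 * hk', Int.mul_ediv_cancel_left _ hne,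
      Int.mul_ediv_cancel_left _ hne]

/-- Conjugating by `diag(1, N)` turns `(p q; N r s)` into the integral matrix `(p N q; r s)`. -/
theorem QF.mk_scale_eq_of_mk_eq {Q Q' : QF D N} (h : FormClass.mk Q = FormClass.mk Q') :
    FormClass.mk (Q.scale hD hN) = FormClass.mk (Q'.scale hD hN) := by
  rw [FormClass.mk_eq_mk] at h ⊢
  obtain ⟨γ, hγ, hQ⟩ := h
  obtain ⟨r, hr⟩ := mem_Gamma0_iff_dvd.1 hγ
  have hdet := γ.det_coe
  rw [Matrix.det_fin_two] at hdet
  refine ⟨⟨!![γ 0 0, γ 0 1 * N; r, γ 1 1], ?_⟩, ?_, ?_⟩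
  · rw [Matrix.det_fin_two_of, ]; linear_combination hdet + γ 0 1 * hr
  · exact mem_Gamma0_iff_dvd.2 (by simp)
  · have h1 := congrArg BinForm.a hQ
    have h2 := congrArg BinForm.b hQ
    have h3 := congrArg BinForm.c hQ
    simp only [BinForm.comp, hr] at h1 h2 h3
    ext
    · simp [BinForm.comp, QF.scale, h1]; ring
    · simp [BinForm.comp, QF.scale, h2]; ring
    · simp [BinForm.comp, QF.scale, h3]; ring

/-- The conjugation can be undone once `N` divides the upper right entry `q`. Comparing coefficients
of `y²` gives `a q² + b N q s + c N² s² = c' N²`, which makes `a q / N` an integer, and `a` is prime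
to `N`. -/
theorem QF.mk_eq_of_mk_scale_eq {Q Q' : QF D N}
    (h : FormClass.mk (Q.scale hD hN) = FormClass.mk (Q'.scale hD hN)) :
    FormClass.mk Q = FormClass.mk Q' := by
  rw [FormClass.mk_eq_mk] at h ⊢
  obtain ⟨γ, -, hQ⟩ := h
  have hdet := γ.det_coe
  rw [Matrix.det_fin_two] at hdet
  have hN0 : (N : ℤ) ≠ 0 := by exact_mod_cast hN.ne'
  have h1 := congrArg BinForm.a hQ
  have h2 := congrArg BinForm.b hQ
  have h3 := congrArg BinForm.c hQ
  simp only [BinForm.comp, QF.scale] at h1 h2 h3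
  -- `a γ₀₁ / N` is a rational root of a monic integral polynomial
  obtain ⟨q, hq⟩ : (N : ℤ) ∣ γ 0 1 := by
    have hroot : IsIntegral ℤ ((Q.a * γ 0 1 : ℚ) / N) := by
      refine ⟨Polynomial.X ^ 2 + Polynomial.C (Q.b * γ 1 1 : ℤ) * Polynomial.X
        + Polynomial.C (Q.a * (Q.c * γ 1 1 ^ 2 - Q'.c)), ?_, ?_⟩
      · monicity!
      · simp only [Polynomial.eval₂_add, Polynomial.eval₂_mul, Polynomial.eval₂_C,
          Polynomial.eval₂_X, Polynomial.eval₂_X_pow]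
        simp only [algebraMap_int_eq, eq_intCast]
        have h3' : (Q'.c * N ^ 2 : ℚ) = Q.a * γ 0 1 ^ 2 + Q.b * N * γ 0 1 * γ 1 1
          + Q.c * N ^ 2 * γ 1 1 ^ 2 := by exact_mod_cast h3
        have hNQ : (N : ℚ) ≠ 0 := by exact_mod_cast hN.ne'
        push_cast
        field_simp
        linear_combination -(Q.a : ℚ) * h3'
    obtain ⟨n, hn⟩ := IsIntegrallyClosed.isIntegral_iff.1 hroot
    have hNQ : (N : ℚ) ≠ 0 := by exact_mod_cast hN.ne'
    have hn' : (n : ℚ) * N = Q.a * γ 0 1 := by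
      have : (n : ℚ) = (Q.a * γ 0 1 : ℚ) / N := by simpa using hn
      rw [this]; field_simp
    have hn'' : n * N = Q.a * γ 0 1 := by exact_mod_cast hn'
    exact Q.coprime.symm.dvd_of_dvd_mul_left ⟨n, by rw [← hn'']; ring⟩
  refine ⟨⟨!![γ 0 0, q; γ 1 0 * N, γ 1 1], ?_⟩, ?_, ?_⟩
  · rw [Matrix.det_fin_two_of, ]; linear_combination hdet + γ 1 0 * hq
  · exact mem_Gamma0_iff_dvd.2 (by simp)
  · rw [hq] at h2 h3
    ext
    · simp [BinForm.comp, h1]; ring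
    · refine mul_left_cancel₀ hN0 ?_
      simp only [BinForm.comp, Matrix.of_apply, Matrix.cons_val', Matrix.cons_val_zero,
        Matrix.cons_val_one, Matrix.cons_val_fin_one]
      linear_combination h2
    · refine mul_left_cancel₀ (pow_ne_zero 2 hN0) ?_
      simp only [BinForm.comp, Matrix.of_apply, Matrix.cons_val', Matrix.cons_val_zero,
        Matrix.cons_val_one, Matrix.cons_val_fin_one]
      linear_combination h3

/-- With leading coefficient prime to `N`, a translation `x ↦ x + k y` makes the middle coefficient
divisible by `N`, with a quotient of the parity of `D`. The discriminant then forces `N²` to divide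
the last coefficient. -/
theorem QF.exists_mk_scale_eq (hD4 : D % 4 = 0 ∨ D % 4 = 1) (x : FormClass (D * (N : ℤ) ^ 2) 1) :
    ∃ Q : QF D N, FormClass.mk (Q.scale hD hN) = x := by
  have hD' : D * (N : ℤ) ^ 2 < 0 := mul_neg_of_neg_of_pos hD (by positivity)
  have hN0 : (N : ℤ) ≠ 0 := by exact_mod_cast hN.ne'
  obtain ⟨F, rfl, hF⟩ := x.exists_rep_isCoprime hD' one_pos hN.ne'
  obtain ⟨u, v, huv⟩ := hF
  have hdisc : F.b ^ 2 - 4 * F.a * F.c = D * (N : ℤ) ^ 2 := F.disc_eq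
  -- translate the middle coefficient to be congruent to `D N` modulo `2 N`
  obtain ⟨e, he⟩ : (2 : ℤ) ∣ F.b - D * N := by
    have h1 := F.toBinForm.disc_dvd
    rw [F.disc_eq] at h1
    have h2 : (2 : ℤ) ∣ D * (N * (N + 1)) :=
      (Int.even_mul_succ_self (N : ℤ)).two_dvd.mul_left _
    have := dvd_sub h1 h2
    have e : F.b + D * (N : ℤ) ^ 2 - D * (N * (N + 1)) = F.b - D * N := by ring
    rwa [e] at this
  -- As `u a + v N = 1`, the choice `k = -u e` gives `e + a k = e (1 - u a) = N v e`.
  obtain ⟨k, w, hkw⟩ : ∃ k w : ℤ, e + F.a * k = N * w :=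
    ⟨-(u * e), v * e, by linear_combination -e * huv⟩
  obtain ⟨m, hm⟩ : (4 : ℤ) ∣ (D + 2 * w) ^ 2 - D := by
    have : (D + 2 * w) ^ 2 - D = D * (D - 1) + 4 * (D * w + w ^ 2) := by ring
    rw [this]
    refine dvd_add ?_ (dvd_mul_right _ _)
    rcases hD4 with h | h
    · exact (Int.dvd_of_emod_eq_zero h).mul_right _
    · exact (Int.dvd_of_emod_eq_zero (by omega)).mul_left _
  have hb : F.b + 2 * F.a * k = (D + 2 * w) * N := by linear_combination he + 2 * hkw
  have hc4 : F.a * (F.c + F.b * k + F.a * k ^ 2) = N ^ 2 * m := by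
    have : 4 * (F.a * (F.c + F.b * k + F.a * k ^ 2)) = 4 * (N ^ 2 * m) := by
      linear_combination -hdisc + (F.b + 2 * F.a * k + (D + 2 * w) * N) * hb + (N : ℤ) ^ 2 * hm
    linarith
  obtain ⟨C, hC⟩ : F.a ∣ m := by
    have h1 : IsCoprime F.a ((N : ℤ) ^ 2) := IsCoprime.pow_right ⟨u, v, huv⟩
    exact h1.dvd_of_dvd_mul_left ⟨_, hc4.symm⟩
  have hc : F.c + F.b * k + F.a * k ^ 2 = C * N ^ 2 := by
    refine mul_left_cancel₀ F.a_pos.ne' ?_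
    rw [hc4, hC]; ring
  let γ : SL(2, ℤ) := ⟨!![1, k; 0, 1], by rw [Matrix.det_fin_two_of]; ring⟩
  have hcomp : F.toBinForm.comp γ = ⟨F.a, (D + 2 * w) * N, C * N ^ 2⟩ := by
    ext
    · simp [BinForm.comp, γ]
    · simp [BinForm.comp, γ]; linear_combination hb
    · simp [BinForm.comp, γ]; linear_combination hc
  have hQdisc : (D + 2 * w) ^ 2 - 4 * F.a * C = D := by
    linear_combination hm + 4 * hC
  have hprim := F.isPrimitive.comp γ
  rw [hcomp, BinForm.isPrimitive_iff] at hprim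
  let Q : QF D N :=
    { a := F.a, b := D + 2 * w, c := C
      isPrimitive := BinForm.isPrimitive_iff.2 fun p hp h1 h2 h3 =>
        hprim p hp h1 (h2.mul_right _) (h3.mul_right _)
      isPosDef := BinForm.isPosDef_of_a_pos F.a_pos (by rw [BinForm.disc, hQdisc]; exact hD)
      disc_eq := hQdisc
      coprime := ⟨u, v, huv⟩ }
  refine ⟨Q, (FormClass.mk_eq_mk.2 ⟨γ, ?_, ?_⟩).symm⟩
  · exact mem_Gamma0_iff_dvd.2 (by simp)
  · rw [hcomp]; rfl

/-- The bijection `C(D, Γ₀(N)) ≃ C(D N²)` induced by `Q(x, y) ↦ Q(x, N y)`. -/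
noncomputable def FormClass.scaleEquiv (hD4 : D % 4 = 0 ∨ D % 4 = 1) :
    FormClass D N ≃ FormClass (D * (N : ℤ) ^ 2) 1 :=
  Equiv.ofBijective
    (Quotient.lift (fun Q => FormClass.mk (Q.scale hD hN)) fun _ _ h =>
      QF.mk_scale_eq_of_mk_eq hD hN (Quotient.sound h)) <| by
    refine ⟨fun x y h => ?_, fun x => ?_⟩
    · obtain ⟨Q, rfl⟩ := x.exists_rep
      obtain ⟨Q', rfl⟩ := y.exists_rep
      exact QF.mk_eq_of_mk_scale_eq hD hN h
    · obtain ⟨Q, hQ⟩ := QF.exists_mk_scale_eq hD hN hD4 x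
      exact ⟨FormClass.mk Q, hQ⟩

end Scale

/-! ### Lattices in `ℂ` attached to forms -/

/-- The square root of the negative integer `D` in the upper half plane. -/
noncomputable def sqrtDisc (D : ℤ) : ℂ := (Real.sqrt (-(D : ℝ)) : ℂ) * Complex.I

theorem sqrtDisc_sq {D : ℤ} (hD : D < 0) : sqrtDisc D ^ 2 = D := by
  have h : (0 : ℝ) ≤ -(D : ℝ) := by
    have : (D : ℝ) < 0 := by exact_mod_cast hD
    linarith
  rw [sqrtDisc, mul_pow, Complex.I_sq, ← Complex.ofReal_pow, Real.sq_sqrt h]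
  push_cast
  ring

theorem sqrtDisc_im_pos {D : ℤ} (hD : D < 0) : 0 < (sqrtDisc D).im := by
  have : (D : ℝ) < 0 := by exact_mod_cast hD
  simpa [sqrtDisc] using this

/-- The quadratic order `ℤ[(D + √D) / 2]` of discriminant `D`. -/
noncomputable def quadOrder (D : ℤ) : Subring ℂ := Subring.closure {((D : ℂ) + sqrtDisc D) / 2}

namespace QF

variable {D : ℤ} {N : ℕ}

/-- The root of `Q(x, 1)` in the upper half plane. -/
noncomputable def root (Q : QF D N) : ℂ := (-(Q.b : ℂ) + sqrtDisc D) / (2 * Q.a)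

theorem a_ne_zero (Q : QF D N) : (Q.a : ℂ) ≠ 0 := by exact_mod_cast Q.a_pos.ne'

theorem two_a_mul_root (Q : QF D N) : 2 * (Q.a : ℂ) * Q.root = -(Q.b : ℂ) + sqrtDisc D := by
  have := Q.a_ne_zero
  rw [root]; field_simp

theorem disc_eq_complex (Q : QF D N) : (Q.b : ℂ) ^ 2 - 4 * Q.a * Q.c = D := by
  exact_mod_cast congrArg (Int.cast : ℤ → ℂ) Q.disc_eq'

theorem root_eq (hD : D < 0) (Q : QF D N) :
    (Q.a : ℂ) * Q.root ^ 2 + Q.b * Q.root + Q.c = 0 := by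
  have h4 : (4 * Q.a : ℂ) ≠ 0 := mul_ne_zero (by norm_num) Q.a_ne_zero
  refine mul_left_cancel₀ h4 ?_
  linear_combination (2 * (Q.a : ℂ) * Q.root + Q.b + sqrtDisc D) * Q.two_a_mul_root
    + sqrtDisc_sq hD - Q.disc_eq_complex

theorem root_im_pos (hD : D < 0) (Q : QF D N) : 0 < Q.root.im := by
  have h := congrArg Complex.im Q.two_a_mul_root
  have ha : (0 : ℝ) < Q.a := by exact_mod_cast Q.a_pos
  have hs := sqrtDisc_im_pos hD
  have h' : 2 * (Q.a : ℝ) * Q.root.im = (sqrtDisc D).im := by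
    simpa [Complex.mul_im, Complex.mul_re] using h
  rw [← h'] at hs
  exact pos_of_mul_pos_right hs (by positivity)

theorem int_eq_of_add_mul_root_eq (hD : D < 0) (Q : QF D N) {x y x' y' : ℤ}
    (h : (x : ℂ) + y * Q.root = x' + y' * Q.root) : x = x' ∧ y = y' := by
  have h1 := congrArg Complex.im h
  simp only [Complex.add_im, Complex.intCast_im, Complex.mul_im, Complex.intCast_re, zero_mul,
    add_zero, zero_add] at h1
  have hy : y = y' := by exact_mod_cast mul_right_cancel₀ (Q.root_im_pos hD).ne' h1
  refine ⟨?_, hy⟩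
  rw [hy] at h
  exact_mod_cast add_right_cancel h

/-- The generator of the order and `a τ` differ by the integer `(b + D) / 2`. This is how the order,
which does not depend on `Q`, acts on `ℤ + ℤ τ`. -/
theorem exists_omega_eq (Q : QF D N) :
    ∃ t : ℤ, ((D : ℂ) + sqrtDisc D) / 2 = Q.a * Q.root + t ∧ Q.b + D = 2 * t := by
  obtain ⟨t, ht⟩ := Q.toBinForm.disc_dvd
  rw [Q.disc_eq] at ht
  refine ⟨t, ?_, ht⟩
  have ht' : (Q.b : ℂ) + D = 2 * t := by exact_mod_cast congrArg (Int.cast : ℤ → ℂ) ht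
  linear_combination -Q.two_a_mul_root / 2 + ht' / 2

theorem a_mul_root_mem (Q : QF D N) : (Q.a : ℂ) * Q.root ∈ quadOrder D := by
  obtain ⟨t, ht, -⟩ := Q.exists_omega_eq
  rw [eq_sub_iff_add_eq.2 ht.symm]
  exact sub_mem (Subring.subset_closure rfl) (intCast_mem _ t)

/-- The lattice `ℤ + ℤ τ`, where `τ` is the root of `Q` in the upper half plane, as a module over
the quadratic order of discriminant `D`. -/
noncomputable def lattice (hD : D < 0) (Q : QF D N) : Submodule (quadOrder D) ℂ where
  carrier := {z | ∃ x y : ℤ, z = x + y * Q.root}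
  zero_mem' := ⟨0, 0, by simp⟩
  add_mem' := by
    rintro _ _ ⟨x, y, rfl⟩ ⟨x', y', rfl⟩
    exact ⟨x + x', y + y', by push_cast; ring⟩
  smul_mem' := by
    rintro ⟨c, hc⟩ z hz
    suffices h : ∀ z : ℂ, (∃ x y : ℤ, z = x + y * Q.root) →
      ∃ x y : ℤ, c * z = x + y * Q.root from h z hz
    clear hz z
    induction hc using Subring.closure_induction with
    | mem c hc =>
      rintro _ ⟨x, y, rfl⟩
      obtain ⟨t, ht, -⟩ := Q.exists_omega_eq
      rw [Set.mem_singleton_iff.1 hc, ht]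
      exact ⟨t * x - Q.c * y, Q.a * x + t * y - Q.b * y, by
        push_cast; linear_combination (y : ℂ) * Q.root_eq hD⟩
    | zero => exact fun _ _ => ⟨0, 0, by simp⟩
    | one => intro z hz; rwa [one_mul]
    | add a b _ _ iha ihb =>
      intro z hz
      obtain ⟨x, y, h⟩ := iha z hz
      obtain ⟨x', y', h'⟩ := ihb z hz
      exact ⟨x + x', y + y', by push_cast; linear_combination h + h'⟩
    | neg a _ iha =>
      intro z hz
      obtain ⟨x, y, h⟩ := iha z hz
      exact ⟨-x, -y, by push_cast; linear_combination -h⟩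
    | mul a b _ _ iha ihb =>
      intro z hz
      rw [mul_assoc]
      exact iha _ (ihb z hz)

theorem one_mem_lattice (hD : D < 0) (Q : QF D N) : (1 : ℂ) ∈ Q.lattice hD :=
  ⟨1, 0, by simp⟩

theorem root_mem_lattice (hD : D < 0) (Q : QF D N) : Q.root ∈ Q.lattice hD :=
  ⟨0, 1, by simp⟩

theorem int_mul_mem {M : Submodule (quadOrder D) ℂ} (n : ℤ) {z : ℂ} (hz : z ∈ M) :
    (n : ℂ) * z ∈ M := by
  rw [← zsmul_eq_mul]
  exact M.toAddSubgroup.zsmul_mem hz n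

theorem lattice_le (hD : D < 0) {Q : QF D N} {M : Submodule (quadOrder D) ℂ} (h1 : (1 : ℂ) ∈ M)
    (h2 : Q.root ∈ M) : Q.lattice hD ≤ M := by
  rintro _ ⟨x, y, rfl⟩
  refine add_mem ?_ (int_mul_mem y h2)
  simpa using int_mul_mem x h1

theorem lattice_mul_le (hD : D < 0) {Q Q' : QF D N} {M : Submodule (quadOrder D) ℂ}
    (h1 : (1 : ℂ) ∈ M) (h2 : Q.root ∈ M) (h3 : Q'.root ∈ M) (h4 : Q.root * Q'.root ∈ M) :
    Q.lattice hD * Q'.lattice hD ≤ M := by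
  rw [Submodule.mul_le]
  rintro _ ⟨x, y, rfl⟩ _ ⟨x', y', rfl⟩
  have e : ((x : ℂ) + y * Q.root) * (x' + y' * Q'.root)
      = ((x * x' : ℤ) : ℂ) * 1 + ((y * x' : ℤ) : ℂ) * Q.root + ((x * y' : ℤ) : ℂ) * Q'.root
        + ((y * y' : ℤ) : ℂ) * (Q.root * Q'.root) := by push_cast; ring
  rw [e]
  exact add_mem (add_mem (add_mem (int_mul_mem _ h1) (int_mul_mem _ h2)) (int_mul_mem _ h3))
    (int_mul_mem _ h4)

/-- The opposite form `a x² - b x y + c y²`. -/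
def opp (hD : D < 0) (Q : QF D N) : QF D N where
  a := Q.a
  b := -Q.b
  c := Q.c
  isPrimitive := BinForm.isPrimitive_iff.2 fun p hp h1 h2 h3 =>
    BinForm.isPrimitive_iff.1 Q.isPrimitive p hp h1 ((dvd_neg (α := ℤ)).1 h2) h3
  isPosDef := BinForm.isPosDef_of_a_pos Q.a_pos <| by
    have : (-Q.b) ^ 2 - 4 * Q.a * Q.c = D := by linear_combination Q.disc_eq'
    rw [BinForm.disc, this]; exact hD
  disc_eq := by
    simp only [BinForm.disc]
    linear_combination Q.disc_eq'
  coprime := Q.coprime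

/-- The root of the opposite form is `τ' = -τ̄`, with `a τ τ' = -c` and `a (τ' - τ) = b`. The
product therefore contains `1`, `b / a` and `c / a`, hence `1 / a` by primitivity. This makes the
lattice of a form invertible. -/
theorem lattice_mul_opp (hD : D < 0) (Q : QF D N) :
    Q.lattice hD * (Q.opp hD).lattice hD = Submodule.span (quadOrder D) {((Q.a : ℂ))⁻¹} := by
  have ha := Q.a_ne_zero
  have h1 := Q.two_a_mul_root
  have h2 : 2 * (Q.a : ℂ) * (Q.opp hD).root = (Q.b : ℂ) + sqrtDisc D := by
    have := (Q.opp hD).two_a_mul_root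
    simpa [opp] using this
  have hprod : (Q.a : ℂ) * (Q.root * (Q.opp hD).root) = -Q.c := by
    have h4 : (4 * Q.a : ℂ) ≠ 0 := mul_ne_zero (by norm_num) ha
    refine mul_left_cancel₀ h4 ?_
    linear_combination (2 * (Q.a : ℂ) * (Q.opp hD).root) * h1 + (-(Q.b : ℂ) + sqrtDisc D) * h2
      + sqrtDisc_sq hD - Q.disc_eq_complex
  have hspan : ∀ z : ℂ, (Q.a : ℂ) * z ∈ quadOrder D →
      z ∈ Submodule.span (quadOrder D) {((Q.a : ℂ))⁻¹} := by
    intro z hz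
    refine Submodule.mem_span_singleton.2 ⟨⟨_, hz⟩, ?_⟩
    change (Q.a : ℂ) * z * (Q.a : ℂ)⁻¹ = z
    field_simp
  refine le_antisymm (lattice_mul_le hD (hspan _ ?_) (hspan _ ?_) (hspan _ ?_) (hspan _ ?_)) ?_
  · rw [mul_one]; exact intCast_mem _ _
  · exact Q.a_mul_root_mem
  · exact (Q.opp hD).a_mul_root_mem
  · rw [hprod]; exact neg_mem (intCast_mem _ _)
  · rw [Submodule.span_singleton_le_iff_mem]
    obtain ⟨u, v, w, huvw⟩ := Q.isPrimitive.exists_bezout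
    have huvw' : (u : ℂ) * Q.a + v * Q.b + w * Q.c = 1 := by exact_mod_cast huvw
    have e : ((Q.a : ℂ))⁻¹ = (u : ℂ) * (1 * 1) + (v : ℂ) * (1 * (Q.opp hD).root)
        + ((-v : ℤ) : ℂ) * (Q.root * 1) + ((-w : ℤ) : ℂ) * (Q.root * (Q.opp hD).root) := by
      refine mul_left_cancel₀ ha ?_
      rw [mul_inv_cancel₀ ha]
      push_cast
      linear_combination -huvw' - v * h2 / 2 + v * h1 / 2 + w * hprod
    rw [e]
    have m1 := Q.one_mem_lattice hD
    have m2 := Q.root_mem_lattice hD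
    have m3 := (Q.opp hD).one_mem_lattice hD
    have m4 := (Q.opp hD).root_mem_lattice hD
    exact add_mem (add_mem (add_mem (int_mul_mem _ (Submodule.mul_mem_mul m1 m3))
      (int_mul_mem _ (Submodule.mul_mem_mul m1 m4)))
      (int_mul_mem _ (Submodule.mul_mem_mul m2 m3))) (int_mul_mem _ (Submodule.mul_mem_mul m2 m4))

/-- Dirichlet composition of forms corresponds to multiplication of lattices. -/
theorem lattice_eq_mul (hD : D < 0) {Q Q' Q'' : QF D N} (h : IsDirichletComposition Q Q' Q'') :
    Q''.lattice hD = Q.lattice hD * Q'.lattice hD := by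
  obtain ⟨hgcd, B, h1, h2, -, ha, hb, -⟩ := h
  obtain ⟨k, hk⟩ := Int.modEq_iff_dvd.1 h1
  obtain ⟨k', hk'⟩ := Int.modEq_iff_dvd.1 h2
  have n1 := Q.a_ne_zero
  have n2 := Q'.a_ne_zero
  have hak : (Q''.a : ℂ) = Q.a * Q'.a := by rw [ha]; push_cast; ring
  have hkC : (Q.b : ℂ) - B = 2 * Q.a * k := by exact_mod_cast congrArg (Int.cast : ℤ → ℂ) hk
  have hkC' : (Q'.b : ℂ) - B = 2 * Q'.a * k' := by exact_mod_cast congrArg (Int.cast : ℤ → ℂ) hk'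
  have hτ'' := Q''.two_a_mul_root
  rw [hak, hb] at hτ''
  -- All roots are expressed by `τ''`: `τ + k = a' τ''` and `τ' + k' = a τ''`, so that `(τ + k) (τ'
  -- + k') = a a' τ''² = -B τ'' - c''`. The product lattice thus contains `a τ''`, `a' τ''` and `B
  -- τ''`, and these yield `τ''`.
  have e1 : Q.root = ((-k : ℤ) : ℂ) * 1 + (Q'.a : ℂ) * Q''.root := by
    refine mul_left_cancel₀ (mul_ne_zero two_ne_zero n1) ?_
    push_cast
    linear_combination Q.two_a_mul_root - hτ'' - hkC
  have e2 : Q'.root = ((-k' : ℤ) : ℂ) * 1 + (Q.a : ℂ) * Q''.root := by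
    refine mul_left_cancel₀ (mul_ne_zero two_ne_zero n2) ?_
    push_cast
    linear_combination Q'.two_a_mul_root - hτ'' - hkC'
  have hroot := Q''.root_eq hD
  rw [hak, hb] at hroot
  have e3 : (Q.root + k) * (Q'.root + k') = -(B : ℂ) * Q''.root - Q''.c := by
    rw [e1, e2]; push_cast; linear_combination hroot
  have m1 := Q''.one_mem_lattice hD
  have m2 := Q''.root_mem_lattice hD
  refine le_antisymm (lattice_le hD ?_ ?_) (lattice_mul_le hD m1 ?_ ?_ ?_)
  · simpa using Submodule.mul_mem_mul (Q.one_mem_lattice hD) (Q'.one_mem_lattice hD)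
  · have p1 := Submodule.mul_mem_mul (Q.one_mem_lattice hD) (Q'.one_mem_lattice hD)
    have p2 := Submodule.mul_mem_mul (Q.root_mem_lattice hD) (Q'.one_mem_lattice hD)
    have p3 := Submodule.mul_mem_mul (Q.one_mem_lattice hD) (Q'.root_mem_lattice hD)
    have p4 := Submodule.mul_mem_mul (Q.root_mem_lattice hD) (Q'.root_mem_lattice hD)
    generalize Q.lattice hD * Q'.lattice hD = M at *
    -- `gcd (a, a', B) = 1`
    have hprim : (⟨Q.a, Q'.a, B⟩ : BinForm).IsPrimitive := by
      refine BinForm.isPrimitive_iff.2 fun p hp g1 g2 g3 => ?_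
      have hp' : (⟨Q.a, Q'.a, (Q.b + Q'.b) / 2⟩ : BinForm).IsPrimitive := hgcd
      refine BinForm.isPrimitive_iff.1 hp' p hp g1 g2 ?_
      have e : (Q.b + Q'.b) / 2 = B + Q.a * k + Q'.a * k' := by
        have : Q.b + Q'.b = 2 * (B + Q.a * k + Q'.a * k') := by linear_combination hk + hk'
        rw [this, Int.mul_ediv_cancel_left _ two_ne_zero]
      change (p : ℤ) ∣ (Q.b + Q'.b) / 2
      rw [e]
      exact dvd_add (dvd_add g3 (g1.mul_right _)) (g2.mul_right _)
    obtain ⟨u, v, w, huvw⟩ := hprim.exists_bezout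
    have huvw' : (u : ℂ) * Q.a + v * Q'.a + w * B = 1 := by exact_mod_cast huvw
    have e : Q''.root = ((u * k' + v * k - w * k * k' - w * Q''.c : ℤ) : ℂ) * (1 * 1)
        + ((v - w * k' : ℤ) : ℂ) * (Q.root * 1) + ((u - w * k : ℤ) : ℂ) * (1 * Q'.root)
        + ((-w : ℤ) : ℂ) * (Q.root * Q'.root) := by
      push_cast at e1 e2 ⊢
      linear_combination -Q''.root * huvw' - v * e1 - u * e2 + w * e3
    rw [e]
    exact add_mem (add_mem (add_mem (int_mul_mem _ p1) (int_mul_mem _ p2)) (int_mul_mem _ p3))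
      (int_mul_mem _ p4)
  · rw [e1]
    exact add_mem (int_mul_mem _ m1) (int_mul_mem _ m2)
  · rw [e2]
    exact add_mem (int_mul_mem _ m1) (int_mul_mem _ m2)
  · have e : Q.root * Q'.root = ((-Q''.c + k * k' : ℤ) : ℂ) * 1
        + ((-B - k * Q.a - k' * Q'.a : ℤ) : ℂ) * Q''.root := by
      push_cast at e1 e2 ⊢
      linear_combination e3 - k' * e1 - k * e2
    rw [e]
    exact add_mem (int_mul_mem _ m1) (int_mul_mem _ m2)

/-- The lattice of a form with leading coefficient `1`. -/
theorem lattice_eq_one (hD : D < 0) (Q : QF D N) (h : Q.a = 1) : Q.lattice hD = 1 := by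
  refine le_antisymm (lattice_le hD (Submodule.one_le.1 le_rfl) ?_) ?_
  · have := Q.a_mul_root_mem
    rw [h, Int.cast_one, one_mul] at this
    exact Submodule.mem_one.2 ⟨⟨_, this⟩, rfl⟩
  · rw [Submodule.one_le]
    exact Q.one_mem_lattice hD

theorem isUnit_lattice (hD : D < 0) (Q : QF D N) : IsUnit (Q.lattice hD) := by
  refine IsUnit.of_mul_eq_one ((Q.opp hD).lattice hD * Submodule.span _ {(Q.a : ℂ)}) ?_
  rw [← mul_assoc, lattice_mul_opp, Submodule.span_mul_span, Set.singleton_mul_singleton,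
    inv_mul_cancel₀ Q.a_ne_zero, ← Submodule.one_eq_span]

/-- Equivalent forms have homothetic lattices. -/
theorem exists_lattice_eq_of_comp (hD : D < 0) {Q Q' : QF D N} {γ : SL(2, ℤ)}
    (h : Q'.toBinForm = Q.toBinForm.comp γ) :
    ∃ l : ℂˣ, Q'.lattice hD = Submodule.span _ {(l : ℂ)} * Q.lattice hD := by
  have hdet := γ.det_coe
  rw [Matrix.det_fin_two] at hdet
  have ha := congrArg (fun F : BinForm => (F.a : ℂ)) h
  have hb := congrArg (fun F : BinForm => (F.b : ℂ)) h
  have hdetC := congrArg (Int.cast : ℤ → ℂ) hdet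
  simp only [BinForm.comp] at ha hb
  push_cast at ha hb hdetC
  generalize γ 0 0 = p at *
  generalize γ 0 1 = q at *
  generalize γ 1 0 = r at *
  generalize γ 1 1 = s at *
  have n1 := Q.a_ne_zero
  have n2 := Q'.a_ne_zero
  -- This says `τ = (p τ' + q) / (r τ' + s)`. The denominator is the homothety factor: it carries
  -- the basis `1, τ` to `r τ' + s, p τ' + q`.
  have hroot : Q.root * (r * Q'.root + s) = p * Q'.root + q := by
    have h4 : 2 * (Q.a : ℂ) * (2 * Q'.a) ≠ 0 := by simp [n1, n2]
    refine mul_left_cancel₀ h4 ?_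
    have hX := Q.two_a_mul_root
    have hY := Q'.two_a_mul_root
    have hd := sqrtDisc_sq hD
    have hd' := Q.disc_eq_complex
    generalize sqrtDisc D = d at *
    have e1 : 2 * (Q.a : ℂ) * (2 * Q'.a) * (Q.root * (r * Q'.root + s))
        = (-(Q.b : ℂ) + d) * (r * (-(Q'.b : ℂ) + d) + 2 * Q'.a * s) := by
      rw [← hX, ← hY]; ring
    have e2 : 2 * (Q.a : ℂ) * (2 * Q'.a) * (p * Q'.root + q)
        = 2 * Q.a * (p * (-(Q'.b : ℂ) + d) + 2 * Q'.a * q) := by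
      rw [← hY]; ring
    rw [e1, e2, ha, hb]
    linear_combination (d * (2 * Q.a * p + Q.b * r) - r * (Q.b ^ 2 - 4 * Q.a * Q.c)) * hdetC
      + r * hd - r * hd'
  have hl : (r : ℂ) * Q'.root + s ≠ 0 := by
    intro h0
    have e : (p : ℂ) * (r * Q'.root + s) - r * (Q.root * (r * Q'.root + s)) = 1 := by
      rw [hroot]; linear_combination hdetC
    rw [h0] at e
    simp at e
  refine ⟨Units.mk0 _ hl, le_antisymm (lattice_le hD ?_ ?_) ?_⟩
  · refine Submodule.mem_span_singleton_mul.2 ⟨(p : ℂ) + ((-r : ℤ) : ℂ) * Q.root, ⟨_, _, rfl⟩, ?_⟩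
    rw [Units.val_mk0]
    push_cast
    linear_combination hdetC - r * hroot
  · refine Submodule.mem_span_singleton_mul.2
      ⟨((-q : ℤ) : ℂ) + (s : ℂ) * Q.root, ⟨_, _, rfl⟩, ?_⟩
    rw [Units.val_mk0]
    push_cast
    linear_combination Q'.root * hdetC + s * hroot
  · rintro z hz
    obtain ⟨_, ⟨x, y, rfl⟩, rfl⟩ := Submodule.mem_span_singleton_mul.1 hz
    refine ⟨x * s + y * q, x * r + y * p, ?_⟩
    rw [Units.val_mk0]
    push_cast
    linear_combination y * hroot

/-- Forms with homothetic lattices are equivalent. -/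
theorem exists_comp_of_lattice_eq (hD : D < 0) {Q Q' : QF D N} {l : ℂˣ}
    (h : Q'.lattice hD = Submodule.span _ {(l : ℂ)} * Q.lattice hD) :
    ∃ γ : SL(2, ℤ), Q'.toBinForm = Q.toBinForm.comp γ := by
  -- The entries of `γ` are the coordinates of `l` and `l τ` in the basis `1, τ'`.
  obtain ⟨s, r, hl⟩ : (l : ℂ) ∈ Q'.lattice hD := by
    rw [h]
    exact Submodule.mem_span_singleton_mul.2 ⟨1, Q.one_mem_lattice hD, mul_one _⟩
  obtain ⟨q, p, hlτ⟩ : (l : ℂ) * Q.root ∈ Q'.lattice hD := by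
    rw [h]
    exact Submodule.mem_span_singleton_mul.2 ⟨_, Q.root_mem_lattice hD, rfl⟩
  have m1 := Q'.one_mem_lattice hD
  have m2 := Q'.root_mem_lattice hD
  rw [h] at m1 m2
  obtain ⟨_, ⟨x, y, rfl⟩, hxy⟩ := Submodule.mem_span_singleton_mul.1 m1
  obtain ⟨_, ⟨x', y', rfl⟩, hxy'⟩ := Submodule.mem_span_singleton_mul.1 m2
  obtain ⟨g1, g2⟩ := Q'.int_eq_of_add_mul_root_eq hD (x := x * s + y * q) (y := x * r + y * p)
    (x' := 1) (y' := 0) (by push_cast; linear_combination hxy - x * hl - y * hlτ)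
  obtain ⟨g3, g4⟩ := Q'.int_eq_of_add_mul_root_eq hD (x := x' * s + y' * q)
    (y := x' * r + y' * p) (x' := 0) (y' := 1)
    (by push_cast; linear_combination hxy' - x' * hl - y' * hlτ)
  -- The determinant is a unit because both pairs are bases of the same lattice. It is positive
  -- because both roots lie in the upper half plane: `det γ * Im τ' = |l|² * Im τ`.
  have hdet : p * s - q * r = 1 := by
    have hpos : 0 < p * s - q * r := by
      have i1 := congrArg Complex.re hl
      have i2 := congrArg Complex.im hl
      have i3 := congrArg Complex.re hlτ
      have i4 := congrArg Complex.im hlτ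
      simp only [Complex.add_re, Complex.add_im, Complex.mul_re, Complex.mul_im,
        Complex.intCast_re, Complex.intCast_im, zero_mul, sub_zero, add_zero, zero_add]
        at i1 i2 i3 i4
      have hl0 : 0 < Complex.normSq (l : ℂ) := Complex.normSq_pos.2 l.ne_zero
      rw [Complex.normSq_apply] at hl0
      have e : ((p * s - q * r : ℤ) : ℝ) * Q'.root.im
          = ((l : ℂ).re * (l : ℂ).re + (l : ℂ).im * (l : ℂ).im) * Q.root.im := by
        push_cast
        linear_combination (-(p : ℝ) * Q'.root.im) * i1 + (q + p * Q'.root.re) * i2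
          + (l : ℂ).im * i3 - (l : ℂ).re * i4
      have h1 := mul_pos hl0 (Q.root_im_pos hD)
      rw [← e] at h1
      exact_mod_cast pos_of_mul_pos_left h1 (Q'.root_im_pos hD).le
    have hunit : (x * y' - y * x') * (p * s - q * r) = 1 := by
      linear_combination (x' * r + y' * p) * g1 - (x' * s + y' * q) * g2 + g4
    have := Int.isUnit_iff.1 (IsUnit.of_mul_eq_one _ ((mul_comm _ _).trans hunit))
    omega
  refine ⟨⟨!![p, q; r, s], by rw [Matrix.det_fin_two_of]; exact hdet⟩, ?_⟩
  set γ : SL(2, ℤ) := ⟨!![p, q; r, s], by rw [Matrix.det_fin_two_of]; exact hdet⟩ with hγ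
  set F := Q.toBinForm.comp γ with hF
  -- The forms `F` and `Q'` share the root `τ'`, so their coefficients are proportional. Equal
  -- discriminants and positive leading coefficients make them equal.
  have hFroot : (F.a : ℂ) * Q'.root ^ 2 + F.b * Q'.root + F.c = 0 := by
    have e1 : F.a = Q.a * p ^ 2 + Q.b * p * r + Q.c * r ^ 2 := by simp [hF, hγ, BinForm.comp]
    have e2 : F.b = 2 * Q.a * p * q + Q.b * (p * s + q * r) + 2 * Q.c * r * s := by
      simp [hF, hγ, BinForm.comp]
    have e3 : F.c = Q.a * q ^ 2 + Q.b * q * s + Q.c * s ^ 2 := by simp [hF, hγ, BinForm.comp]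
    rw [e1, e2, e3]
    push_cast
    have e : (Q.a : ℂ) * (q + p * Q'.root) ^ 2 + Q.b * (q + p * Q'.root) * (s + r * Q'.root)
        + Q.c * (s + r * Q'.root) ^ 2 = 0 := by
      rw [← hl, ← hlτ]
      linear_combination (l : ℂ) ^ 2 * Q.root_eq hD
    linear_combination e
  obtain ⟨k2, k1⟩ := Q'.int_eq_of_add_mul_root_eq hD (x := F.a * Q'.c - Q'.a * F.c)
    (y := F.a * Q'.b - Q'.a * F.b) (x' := 0) (y' := 0)
    (by push_cast; linear_combination F.a * Q'.root_eq hD - Q'.a * hFroot)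
  have hFdisc : F.b ^ 2 - 4 * F.a * F.c = D := by
    have := Q.toBinForm.disc_comp γ
    rw [Q.disc_eq] at this
    exact this
  have hpos : 0 < F.a := Q.isPosDef.comp_a_pos γ
  have hsq : Q'.a ^ 2 = F.a ^ 2 := by
    refine mul_right_cancel₀ hD.ne ?_
    linear_combination -(Q'.a ^ 2) * hFdisc + F.a ^ 2 * Q'.disc_eq'
      - (F.a * Q'.b + Q'.a * F.b) * k1 + 4 * F.a * Q'.a * k2
  have ha : Q'.a = F.a := (pow_left_inj₀ Q'.a_pos.le hpos.le two_ne_zero).1 hsq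
  rw [ha] at k1 k2
  ext
  · exact ha
  · exact mul_left_cancel₀ hpos.ne' (by linarith)
  · exact mul_left_cancel₀ hpos.ne' (by linarith)

end QF

/-! ### The form class group -/

/-- The invertible principal modules over the quadratic order of discriminant `D`. -/
noncomputable def principalHom (D : ℤ) : ℂˣ →* (Submodule (quadOrder D) ℂ)ˣ :=
  Units.map
    { toFun := fun z => Submodule.span _ {z}
      map_one' := Submodule.one_eq_span.symm
      map_mul' := fun z w => by rw [Submodule.span_mul_span, Set.singleton_mul_singleton] }

/-- The invertible modules over the quadratic order of discriminant `D`, up to homothety. -/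
abbrev LatticeClassGroup (D : ℤ) : Type :=
  (Submodule (quadOrder D) ℂ)ˣ ⧸ (principalHom D).range

theorem LatticeClassGroup.mk_eq_mk {D : ℤ} {u v : (Submodule (quadOrder D) ℂ)ˣ} :
    (u : LatticeClassGroup D) = v ↔ ∃ l : ℂˣ,
      (v : Submodule (quadOrder D) ℂ) =
        Submodule.span (quadOrder D) {(l : ℂ)} * (u : Submodule (quadOrder D) ℂ) := by
  rw [QuotientGroup.eq]
  refine exists_congr fun l => ?_
  rw [eq_inv_mul_iff_mul_eq, eq_comm, mul_comm, Units.ext_iff]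
  rfl

section

variable {D : ℤ}

/-- The class of the lattice of a form. -/
noncomputable def QF.latticeClass (hD : D < 0) {N : ℕ} (Q : QF D N) : LatticeClassGroup D :=
  (Q.isUnit_lattice hD).unit

theorem QF.latticeClass_eq_mul (hD : D < 0) {N : ℕ} {Q Q' Q'' : QF D N}
    (h : IsDirichletComposition Q Q' Q'') :
    Q''.latticeClass hD = Q.latticeClass hD * Q'.latticeClass hD := by
  rw [latticeClass, latticeClass, latticeClass, ← QuotientGroup.mk_mul]
  congr 1
  exact Units.ext (QF.lattice_eq_mul hD h)

theorem QF.latticeClass_mul_opp (hD : D < 0) {N : ℕ} (Q : QF D N) :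
    Q.latticeClass hD * (Q.opp hD).latticeClass hD = 1 := by
  have h := Q.lattice_mul_opp hD
  rw [latticeClass, latticeClass, ← QuotientGroup.mk_mul, QuotientGroup.eq_one_iff]
  exact ⟨(Units.mk0 _ Q.a_ne_zero)⁻¹, Units.ext h.symm⟩

/-- At level 1 the group `Γ₀(1)` is all of `SL(2, ℤ)`, so a homothety of lattices gives an
equivalence with no further condition on the matrix. -/
theorem QF.latticeClass_eq_iff (hD : D < 0) {Q Q' : QF D 1} :
    Q.latticeClass hD = Q'.latticeClass hD ↔ FormClass.mk Q = FormClass.mk Q' := by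
  rw [latticeClass, latticeClass, LatticeClassGroup.mk_eq_mk, FormClass.mk_eq_mk]
  constructor
  · rintro ⟨l, hl⟩
    obtain ⟨γ, hγ⟩ := QF.exists_comp_of_lattice_eq hD hl
    exact ⟨γ, mem_Gamma0_iff_dvd.2 (by simp), hγ⟩
  · rintro ⟨γ, -, hγ⟩
    exact QF.exists_lattice_eq_of_comp hD hγ

/-- The lattice class attached to a class of forms. -/
noncomputable def FormClass.latticeClass (hD : D < 0) (x : FormClass D 1) : LatticeClassGroup D :=
  Quotient.lift (fun Q => Q.latticeClass hD)
    (fun _ _ h => (QF.latticeClass_eq_iff hD).2 (Quotient.sound h)) x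

theorem FormClass.latticeClass_mk (hD : D < 0) (Q : QF D 1) :
    (FormClass.mk Q).latticeClass hD = Q.latticeClass hD := rfl

theorem FormClass.latticeClass_injective (hD : D < 0) :
    Function.Injective (FormClass.latticeClass hD) := by
  intro x y h
  obtain ⟨Q, rfl⟩ := x.exists_rep
  obtain ⟨Q', rfl⟩ := y.exists_rep
  exact (QF.latticeClass_eq_iff hD).1 h

/-- A form of discriminant `D` with leading coefficient `1`. -/
theorem QF.exists_a_eq_one (hD : D < 0) (hD4 : D % 4 = 0 ∨ D % 4 = 1) (N : ℕ) :
    ∃ Q : QF D N, Q.a = 1 := by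
  obtain ⟨m, hm⟩ : (4 : ℤ) ∣ D ^ 2 - D := by
    rw [show D ^ 2 - D = D * (D - 1) by ring]
    rcases hD4 with h | h
    · exact (Int.dvd_of_emod_eq_zero h).mul_right _
    · exact (Int.dvd_of_emod_eq_zero (by omega)).mul_left _
  have hd : D ^ 2 - 4 * 1 * m = D := by linear_combination hm
  refine ⟨⟨⟨1, D, m⟩, ?_, BinForm.isPosDef_of_a_pos one_pos ?_, hd, isCoprime_one_left⟩, rfl⟩
  · exact Int.one_gcd
  · rw [BinForm.disc, hd]; exact hD

/-- The lattice classes of forms make up a subgroup. -/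
noncomputable def formLatticeClasses (hD : D < 0) (hD4 : D % 4 = 0 ∨ D % 4 = 1) :
    Subgroup (LatticeClassGroup D) where
  carrier := Set.range (FormClass.latticeClass hD)
  one_mem' := by
    obtain ⟨Q, hQ⟩ := QF.exists_a_eq_one hD hD4 1
    refine ⟨FormClass.mk Q, ?_⟩
    have h : (Q.isUnit_lattice hD).unit = 1 := Units.ext (Q.lattice_eq_one hD hQ)
    rw [FormClass.latticeClass_mk, QF.latticeClass, h, QuotientGroup.mk_one]
  mul_mem' := by
    rintro _ _ ⟨x, rfl⟩ ⟨y, rfl⟩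
    obtain ⟨Q, Q', Q'', rfl, rfl, h⟩ := FormClass.exists_isDirichletComposition hD one_pos x y
    exact ⟨FormClass.mk Q'', QF.latticeClass_eq_mul hD h⟩
  inv_mem' := by
    rintro _ ⟨x, rfl⟩
    obtain ⟨Q, rfl⟩ := x.exists_rep
    exact ⟨FormClass.mk (Q.opp hD), eq_inv_of_mul_eq_one_right (Q.latticeClass_mul_opp hD)⟩

/-- A bijection onto a commutative group that turns Dirichlet composition into multiplication
induces a Dirichlet group structure. -/
theorem exists_isDirichletGroup_of_equiv (hD : D < 0) {N : ℕ} (hN : 0 < N) {G : Type*} [CommGroup G]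
    (e : FormClass D N ≃ G)
    (hmul : ∀ Q Q' Q'' : QF D N, IsDirichletComposition Q Q' Q'' →
      e (.mk Q'') = e (.mk Q) * e (.mk Q')) :
    ∃ H : CommGroup (FormClass D N), IsDirichletGroup H ∧ Nonempty (FormClass D N ≃* G) := by
  let H : CommGroup (FormClass D N) := e.commGroup
  have he : ∀ x y : FormClass D N, e (x * y) = e x * e y := fun x y => e.apply_symm_apply _
  refine ⟨H, fun x y z => ?_, ⟨⟨e, he⟩⟩⟩
  rw [← FormClass.map_eq_mul_iff hD hN e e.injective hmul, ← he]
  exact e.injective.eq_iff.symm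

theorem exists_isDirichletGroup (hD : D < 0) (hD4 : D % 4 = 0 ∨ D % 4 = 1) :
    ∃ H : CommGroup (FormClass D 1), IsDirichletGroup H := by
  let e : FormClass D 1 ≃ formLatticeClasses hD hD4 :=
    Equiv.ofInjective _ (FormClass.latticeClass_injective hD)
  have he : ∀ x, (e x : LatticeClassGroup D) = x.latticeClass hD := fun _ => rfl
  obtain ⟨H, hH, -⟩ := exists_isDirichletGroup_of_equiv hD one_pos e fun Q Q' Q'' h =>
    Subtype.ext (by
      rw [Subgroup.coe_mul, he, he, he]
      exact QF.latticeClass_eq_mul hD h)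
  exact ⟨H, hH⟩

theorem exists_dirichletGroup_mulEquiv (hD : D < 0) (hD4 : D % 4 = 0 ∨ D % 4 = 1) {N : ℕ}
    (hN : 0 < N) :
    ∃ (G : CommGroup (FormClass D N)) (H : CommGroup (FormClass (D * (N : ℤ) ^ 2) 1)),
      IsDirichletGroup G ∧ IsDirichletGroup H ∧
      Nonempty (FormClass D N ≃* FormClass (D * (N : ℤ) ^ 2) 1) := by
  have hD' : D * (N : ℤ) ^ 2 < 0 := mul_neg_of_neg_of_pos hD (by positivity)
  have hD4' : D * (N : ℤ) ^ 2 % 4 = 0 ∨ D * (N : ℤ) ^ 2 % 4 = 1 := by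
    have h2 : ((N : ℤ) ^ 2) % 4 = 0 ∨ ((N : ℤ) ^ 2) % 4 = 1 := by
      rcases Int.even_or_odd' (N : ℤ) with ⟨m, hm | hm⟩
      · left; rw [hm, show (2 * m) ^ 2 = 4 * m ^ 2 by ring]; omega
      · right; rw [hm, show (2 * m + 1) ^ 2 = 4 * (m ^ 2 + m) + 1 by ring]; omega
    rw [Int.mul_emod]
    rcases hD4 with h | h <;> rcases h2 with h' | h' <;> simp [h, h']
  obtain ⟨H, hH⟩ := exists_isDirichletGroup hD' hD4'
  obtain ⟨G, hG, hGH⟩ := exists_isDirichletGroup_of_equiv hD hN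
    (FormClass.scaleEquiv hD hN hD4) fun Q Q' Q'' h =>
      (hH _ _ _).2 ⟨_, _, _, rfl, rfl, rfl, QF.isDirichletComposition_scale hD hN h⟩
  exact ⟨G, H, hG, hH, hGH⟩

end

/-! ### Ideals prime to `N` -/

/-- Fractions of elements of a submonoid already form a subgroup. This reduces the generated ideal
groups to quotients of two integral ideals. -/
theorem exists_mul_inv_of_mem_closure {A : Type*} [CommGroup A] {S : Set A} (h1 : (1 : A) ∈ S)
    (hmul : ∀ a ∈ S, ∀ b ∈ S, a * b ∈ S) {u : A} (hu : u ∈ Subgroup.closure S) :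
    ∃ a ∈ S, ∃ b ∈ S, u = a * b⁻¹ := by
  induction hu using Subgroup.closure_induction with
  | mem x hx => exact ⟨x, hx, 1, h1, by simp⟩
  | one => exact ⟨1, h1, 1, h1, by simp⟩
  | mul x y _ _ hx hy =>
    obtain ⟨a, ha, b, hb, rfl⟩ := hx
    obtain ⟨a', ha', b', hb', rfl⟩ := hy
    exact ⟨a * a', hmul _ ha _ ha', b * b', hmul _ hb _ hb', by rw [mul_inv]; ac_rfl⟩
  | inv x _ hx =>
    obtain ⟨a, ha, b, hb, rfl⟩ := hx
    exact ⟨b, hb, a, ha, by rw [mul_inv, inv_inv, mul_comm]⟩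

/-- Both quotients are images of `J'`, with the same kernel. In the application `J' = I(O', N)`, `I
= I(O', 1)`, `P = P(O', 1)`, `J = I(O, N)`, `P₀ = P₀(O, N)` and `E` is extension of ideals. -/
theorem nonempty_quotient_mulEquiv {A B : Type*} [CommGroup A] [CommGroup B] (E : A →* B)
    {J' I P : Subgroup A} {J P₀ : Subgroup B} (hJI : J' ≤ I) (hmap : J'.map E = J)
    (hI : ∀ u ∈ I, ∃ v ∈ J', v⁻¹ * u ∈ P) (hP : ∀ u ∈ J', E u ∈ P₀ ↔ u ∈ P) :
    Nonempty (J ⧸ P₀.subgroupOf J ≃* I ⧸ P.subgroupOf I) := by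
  have hE : ∀ u : J', E u ∈ J := fun u => hmap ▸ Subgroup.mem_map_of_mem E u.2
  let φ : J' →* I ⧸ P.subgroupOf I := (QuotientGroup.mk' _).comp (Subgroup.inclusion hJI)
  let ψ : J' →* J ⧸ P₀.subgroupOf J :=
    (QuotientGroup.mk' _).comp ((E.comp J'.subtype).codRestrict J hE)
  have hφ : Function.Surjective φ := by
    intro x
    obtain ⟨⟨u, hu⟩, rfl⟩ := QuotientGroup.mk_surjective x
    obtain ⟨v, hv, h⟩ := hI u hu
    exact ⟨⟨v, hv⟩, QuotientGroup.eq.2 h⟩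
  have hψ : Function.Surjective ψ := by
    intro x
    obtain ⟨⟨u, hu⟩, rfl⟩ := QuotientGroup.mk_surjective x
    obtain ⟨v, hv, h⟩ := Subgroup.mem_map.1 (hmap.symm ▸ hu)
    exact ⟨⟨v, hv⟩, congrArg (QuotientGroup.mk' (P₀.subgroupOf J)) (Subtype.ext h)⟩
  have hker : ψ.ker = φ.ker := by
    ext u
    have h1 : ψ u = 1 ↔ E u ∈ P₀ := QuotientGroup.eq_one_iff _
    have h2 : φ u = 1 ↔ (u : A) ∈ P := QuotientGroup.eq_one_iff _
    rw [MonoidHom.mem_ker, MonoidHom.mem_ker, h1, h2, hP u u.2]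
  exact ⟨(QuotientGroup.quotientKerEquivOfSurjective ψ hψ).symm.trans
    ((QuotientGroup.quotientMulEquivOfEq hker).trans
      (QuotientGroup.quotientKerEquivOfSurjective φ hφ))⟩

section PrimeTo

variable {K : Type*} [Field K] {O : Subring K} {N : ℕ}

theorem isPrimeTo_iff_exists {𝔞 : Ideal O} :
    IsPrimeTo 𝔞 N ↔ ∃ x ∈ 𝔞, ∃ y : O, x + N * y = 1 := by
  rw [IsPrimeTo, Ideal.eq_top_iff_one, Submodule.mem_sup]
  refine exists_congr fun x => and_congr_right fun _ => ⟨?_, ?_⟩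
  · rintro ⟨z, hz, h⟩
    obtain ⟨y, rfl⟩ := Ideal.mem_span_singleton.1 hz
    exact ⟨y, h⟩
  · rintro ⟨y, h⟩
    exact ⟨_, Ideal.mem_span_singleton.2 (dvd_mul_right _ y), h⟩

theorem IsPrimeTo.mul {𝔞 𝔟 : Ideal O} (ha : IsPrimeTo 𝔞 N) (hb : IsPrimeTo 𝔟 N) :
    IsPrimeTo (𝔞 * 𝔟) N :=
  Ideal.isCoprime_iff_sup_eq.1
    ((Ideal.isCoprime_iff_sup_eq.2 ha).mul_left (Ideal.isCoprime_iff_sup_eq.2 hb))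

theorem isPrimeTo_one (𝔞 : Ideal O) : IsPrimeTo 𝔞 1 :=
  isPrimeTo_iff_exists.2 ⟨0, 𝔞.zero_mem, 1, by simp⟩

theorem mem_idealsPrimeTo {u : IdealGroup O} {𝔞 : Ideal O} (hu : (u : FractionalIdeal O⁰ K) = 𝔞)
    (ha : IsPrimeTo 𝔞 N) : u ∈ idealsPrimeTo O N :=
  Subgroup.subset_closure ⟨𝔞, hu, hu ▸ isProper_of_isUnit u.isUnit, ha⟩

theorem exists_of_mem_idealsPrimeTo {u : IdealGroup O} (hu : u ∈ idealsPrimeTo O N) :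
    ∃ (v w : IdealGroup O) (𝔞 𝔟 : Ideal O), u = v * w⁻¹ ∧ (v : FractionalIdeal O⁰ K) = 𝔞 ∧
      (w : FractionalIdeal O⁰ K) = 𝔟 ∧ IsPrimeTo 𝔞 N ∧ IsPrimeTo 𝔟 N := by
  obtain ⟨v, ⟨𝔞, hv, -, ha⟩, w, ⟨𝔟, hw, -, hb⟩, rfl⟩ := exists_mul_inv_of_mem_closure
    (S := {u : IdealGroup O | ∃ 𝔞 : Ideal O, (u : FractionalIdeal O⁰ K) = 𝔞 ∧
      IsProper (𝔞 : FractionalIdeal O⁰ K) ∧ IsPrimeTo 𝔞 N})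
    ⟨⊤, by rw [Units.val_one, FractionalIdeal.coeIdeal_top], by
      rw [FractionalIdeal.coeIdeal_top]; exact isProper_of_isUnit isUnit_one,
      isPrimeTo_iff_exists.2 ⟨1, trivial, 0, by simp⟩⟩
    (by
      rintro v ⟨𝔞, hv, -, ha⟩ w ⟨𝔟, hw, -, hb⟩
      have h : ((v * w : IdealGroup O) : FractionalIdeal O⁰ K) = (𝔞 * 𝔟 : Ideal O) := by
        rw [Units.val_mul, hv, hw, FractionalIdeal.coeIdeal_mul]
      exact ⟨𝔞 * 𝔟, h, h ▸ isProper_of_isUnit (v * w).isUnit, ha.mul hb⟩) hu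
  exact ⟨v, w, 𝔞, 𝔟, rfl, hv, hw, ha, hb⟩

theorem exists_of_mem_principalPrimeTo_one {u : IdealGroup O} (hu : u ∈ principalPrimeTo O 1) :
    ∃ (v w : IdealGroup O) (α β : O), u = v * w⁻¹ ∧
      (v : FractionalIdeal O⁰ K) = (Ideal.span {α} : Ideal O) ∧
      (w : FractionalIdeal O⁰ K) = (Ideal.span {β} : Ideal O) := by
  obtain ⟨v, ⟨α, hv, -⟩, w, ⟨β, hw, -⟩, rfl⟩ := exists_mul_inv_of_mem_closure
    (S := {u : IdealGroup O | ∃ α : O, (u : FractionalIdeal O⁰ K) = (Ideal.span {α} : Ideal O) ∧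
      IsPrimeTo (Ideal.span {α}) 1})
    ⟨1, by
      rw [Units.val_one, Ideal.span_singleton_one, FractionalIdeal.coeIdeal_top], isPrimeTo_one _⟩
    (by
      rintro v ⟨α, hv, -⟩ w ⟨β, hw, -⟩
      refine ⟨α * β, ?_, isPrimeTo_one _⟩
      rw [Units.val_mul, hv, hw, ← FractionalIdeal.coeIdeal_mul,
        Ideal.span_singleton_mul_span_singleton]) hu
  exact ⟨v, w, α, β, rfl, hv, hw⟩

theorem ne_bot_of_units_eq {u : IdealGroup O} {𝔞 : Ideal O}
    (hu : (u : FractionalIdeal O⁰ K) = 𝔞) : 𝔞 ≠ ⊥ := by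
  rintro rfl
  rw [FractionalIdeal.coeIdeal_bot] at hu
  exact u.ne_zero hu

theorem ne_zero_of_units_eq_span {u : IdealGroup O} {α : O}
    (hu : (u : FractionalIdeal O⁰ K) = (Ideal.span {α} : Ideal O)) : α ≠ 0 := by
  rintro rfl
  exact ne_bot_of_units_eq hu (by simp)

theorem IsPrimeTo.exists_ne_zero {𝔞 : Ideal O} (ha : IsPrimeTo 𝔞 N) (h0 : 𝔞 ≠ ⊥) :
    ∃ x ∈ 𝔞, x ≠ 0 ∧ ∃ y : O, x + N * y = 1 := by
  obtain ⟨x, hx, y, h⟩ := isPrimeTo_iff_exists.1 ha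
  by_cases hx0 : x = 0
  -- Here `N y = 1`, so `N` is invertible and any nonzero `z` of the ideal can replace `x`.
  · obtain ⟨z, hz, hz0⟩ := Submodule.exists_mem_ne_zero_of_ne_bot h0
    rw [hx0, zero_add] at h
    exact ⟨z, hz, hz0, y * (1 - z), by linear_combination (1 - z) * h⟩
  · exact ⟨x, hx, hx0, y, h⟩

section Principal

variable [IsFractionRing O K]

/-- The principal ideal generated by a nonzero element of `O`. -/
noncomputable def principalUnit (α : O) (hα : α ≠ 0) : IdealGroup O :=
  toPrincipalIdeal O K (Units.mk0 (α : K) (by simpa using hα))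

theorem coe_principalUnit (α : O) (hα : α ≠ 0) :
    (principalUnit (K := K) α hα : FractionalIdeal O⁰ K) = (Ideal.span {α} : Ideal O) := by
  rw [principalUnit, coe_toPrincipalIdeal, FractionalIdeal.coeIdeal_span_singleton]
  rfl

theorem principalUnit_mem (α : O) (hα : α ≠ 0) :
    principalUnit (K := K) α hα ∈ principalPrimeTo O 1 :=
  Subgroup.subset_closure ⟨α, coe_principalUnit α hα, isPrimeTo_one _⟩

theorem toPrincipalIdeal_mem (x : Kˣ) : toPrincipalIdeal O K x ∈ principalPrimeTo O 1 := by
  obtain ⟨α, β, hβ, h⟩ := IsFractionRing.div_surjective (A := O) (x : K)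
  have hβ0 : β ≠ 0 := nonZeroDivisors.ne_zero hβ
  have hβK : (β : K) ≠ 0 := by simpa using hβ0
  have hαK : (α : K) = x * β := by
    have h' : (α : K) / β = x := h
    rw [← h']; field_simp
  have hα0 : α ≠ 0 := by
    rintro rfl
    exact mul_ne_zero x.ne_zero hβK (by rw [← hαK]; simp)
  have e : toPrincipalIdeal O K x = principalUnit α hα0 * (principalUnit β hβ0)⁻¹ := by
    rw [principalUnit, principalUnit, ← map_inv, ← map_mul]
    congr 1
    ext
    simp only [Units.val_mul, Units.val_mk0, Units.val_inv_eq_inv_val]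
    rw [hαK]; field_simp
  rw [e]
  exact mul_mem (principalUnit_mem _ _) (inv_mem (principalUnit_mem _ _))

end Principal

end PrimeTo

/-! ### Comparison of the ideals of two orders `O' ⊆ O` with `N O ⊆ O'` -/

section Extension

variable {K : Type*} [Field K] {O O' : Subring K} (hle : O' ≤ O) {N : ℕ}

theorem isPrimeTo_map {𝔞 : Ideal O'} (h : IsPrimeTo 𝔞 N) :
    IsPrimeTo (𝔞.map (Subring.inclusion hle)) N := by
  obtain ⟨x, hx, y, h⟩ := isPrimeTo_iff_exists.1 h
  refine isPrimeTo_iff_exists.2 ⟨_, Ideal.mem_map_of_mem _ hx, Subring.inclusion hle y, ?_⟩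
  simpa using congrArg (Subring.inclusion hle) h

/-- The element `y` lies only in `O`, but squaring gives `x (x + 2 N y) + N (N y²) = 1`, where `N y`
and `N y²` lie in `O'`. -/
theorem isPrimeTo_of_add_eq_one
    (hN : ∀ x ∈ O, (N : K) * x ∈ O')
    {𝔞 : Ideal O'} {x : O'} (hx : x ∈ 𝔞) {y : O}
    (h : (x : K) + N * y = 1) : IsPrimeTo 𝔞 N := by
  -- square the relation
  let z : O' := ⟨N * (y : K), hN _ y.2⟩
  let w : O' := ⟨N * ((y * y : O) : K), hN _ (y * y).2⟩
  refine isPrimeTo_iff_exists.2 ⟨x * (x + z + z), 𝔞.mul_mem_right _ hx, w, Subtype.ext ?_⟩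
  have e : (x : K) * (x + N * y + N * y) + N * (N * (y * y)) = 1 := by
    linear_combination (x + N * y + 1 : K) * h
  simpa [z, w] using e

theorem isPrimeTo_comap
    (hN : ∀ x ∈ O, (N : K) * x ∈ O')
    {𝔞 : Ideal O} (h : IsPrimeTo 𝔞 N) :
    IsPrimeTo (𝔞.comap (Subring.inclusion hle)) N := by
  obtain ⟨x, hx, y, h⟩ := isPrimeTo_iff_exists.1 h
  have hK : (x : K) + N * y = 1 := by simpa using congrArg (Subtype.val : O → K) h
  have hxO : (x : K) ∈ O' := by
    rw [eq_sub_of_add_eq hK]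
    exact sub_mem (one_mem _) (hN _ y.2)
  exact isPrimeTo_of_add_eq_one hN (x := ⟨x, hxO⟩) hx hK

/-- For `x + N y = 1` with `x` in the contraction, `z = z x + y (N z)`, and `N z` lies in the
contraction because `N O ⊆ O'`. -/
theorem map_comap_eq
    (hN : ∀ x ∈ O, (N : K) * x ∈ O')
    {𝔞 : Ideal O} (h : IsPrimeTo 𝔞 N) :
    (𝔞.comap (Subring.inclusion hle)).map (Subring.inclusion hle) = 𝔞 := by
  refine le_antisymm Ideal.map_comap_le fun z hz => ?_
  obtain ⟨x, hx, y, h⟩ := isPrimeTo_iff_exists.1 (isPrimeTo_comap hle hN h)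
  have hK : (x : K) + N * y = 1 := by simpa using congrArg (Subtype.val : O' → K) h
  let w : O' := ⟨N * (z : K), hN _ z.2⟩
  have hw : w ∈ 𝔞.comap (Subring.inclusion hle) := by
    have : Subring.inclusion hle w = N * z := Subtype.ext (by simp [w])
    rw [Ideal.mem_comap, this]
    exact 𝔞.mul_mem_left _ hz
  have e : z = z * Subring.inclusion hle x + Subring.inclusion hle y * Subring.inclusion hle w := by
    refine Subtype.ext ?_
    have : (z : K) = z * x + y * (N * z) := by linear_combination -(z : K) * hK
    simpa [w] using this
  rw [e]
  exact add_mem (Ideal.mul_mem_left _ _ (Ideal.mem_map_of_mem _ hx))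
    (Ideal.mul_mem_left _ _ (Ideal.mem_map_of_mem _ hw))

theorem comap_map_eq
    (hN : ∀ x ∈ O, (N : K) * x ∈ O')
    {𝔞 : Ideal O'} (h : IsPrimeTo 𝔞 N) :
    (𝔞.map (Subring.inclusion hle)).comap (Subring.inclusion hle) = 𝔞 := by
  refine le_antisymm (fun z hz => ?_) Ideal.le_comap_map
  obtain ⟨x, hx, y, h⟩ := isPrimeTo_iff_exists.1 h
  -- In short, `N 𝔞 O ⊆ 𝔞`. The extra factor `c` lets the induction pass through scalar multiples.
  have key : ∀ w ∈ 𝔞.map (Subring.inclusion hle), ∀ c : O, ∃ v ∈ 𝔞, (v : K) = N * (c * w) := by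
    intro w hw
    induction hw using Submodule.span_induction with
    | mem w hw =>
      obtain ⟨v, hv, rfl⟩ := hw
      exact fun c => ⟨⟨N * (c : K), hN _ c.2⟩ * v, 𝔞.mul_mem_left _ hv, by simp [mul_assoc]⟩
    | zero => exact fun c => ⟨0, 𝔞.zero_mem, by simp⟩
    | add a b _ _ ha hb =>
      intro c
      obtain ⟨v, hv, e⟩ := ha c
      obtain ⟨v', hv', e'⟩ := hb c
      exact ⟨v + v', add_mem hv hv', by simp [e, e', mul_add]⟩
    | smul d w _ hw =>
      intro c
      obtain ⟨v, hv, e⟩ := hw (c * d)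
      exact ⟨v, hv, by simp [e, mul_assoc]⟩
  obtain ⟨v, hv, e⟩ := key _ hz 1
  have : z = z * x + y * v := by
    refine Subtype.ext ?_
    have hK : (x : K) + N * y = 1 := by simpa using congrArg (Subtype.val : O' → K) h
    have e' : (v : K) = N * z := by simpa using e
    have : (z : K) = z * x + y * v := by rw [e']; linear_combination -(z : K) * hK
    simpa using this
  rw [this]
  exact add_mem (𝔞.mul_mem_left _ hx) (𝔞.mul_mem_left _ hv)

/-- Take `s + N t = 1` with `s` in the contraction and let `x` preserve it. For `y ∈ 𝔞`, `x y = y (x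
s) + t (x N y)` lies in `𝔞`, so `x ∈ O` by properness of `𝔞`. Then `x = x s + N (x t)` lies in `O'`.
-/
theorem isProper_comap
    (hN : ∀ x ∈ O, (N : K) * x ∈ O')
    {𝔞 : Ideal O} (h : IsPrimeTo 𝔞 N)
    (hp : IsProper (𝔞 : FractionalIdeal O⁰ K)) :
    IsProper ((𝔞.comap (Subring.inclusion hle) : Ideal O') : FractionalIdeal O'⁰ K) := by
  intro x
  refine ⟨fun hx y hy => (Submodule.smul_mem _ (⟨x, hx⟩ : O') hy), fun hx => ?_⟩
  have hx' : ∀ y ∈ 𝔞.comap (Subring.inclusion hle), ∃ z ∈ 𝔞.comap (Subring.inclusion hle),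
      (z : K) = x * y := by
    intro y hy
    obtain ⟨z, hz, e⟩ := (FractionalIdeal.mem_coeIdeal _).1
      (hx y ((FractionalIdeal.mem_coeIdeal _).2 ⟨y, hy, rfl⟩))
    exact ⟨z, hz, e⟩
  obtain ⟨s, hs, t, hst⟩ := isPrimeTo_iff_exists.1 (isPrimeTo_comap hle hN h)
  have hK : (s : K) + N * t = 1 := by simpa using congrArg (Subtype.val : O' → K) hst
  obtain ⟨v, hv, ev⟩ := hx' s hs
  have hxO : x ∈ O := by
    refine (hp x).2 fun _ hy' => ?_
    obtain ⟨y, hy, rfl⟩ := (FractionalIdeal.mem_coeIdeal _).1 hy'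
    let w : O' := ⟨N * (y : K), hN _ y.2⟩
    have hw : w ∈ 𝔞.comap (Subring.inclusion hle) := by
      have : Subring.inclusion hle w = N * y := Subtype.ext (by simp [w])
      rw [Ideal.mem_comap, this]
      exact 𝔞.mul_mem_left _ hy
    obtain ⟨v', hv', ev'⟩ := hx' w hw
    refine (FractionalIdeal.mem_coeIdeal _).2
      ⟨y * Subring.inclusion hle v + Subring.inclusion hle t * Subring.inclusion hle v',
        add_mem (𝔞.mul_mem_left _ hv) (𝔞.mul_mem_left _ hv'), ?_⟩
    change (y : K) * v + t * v' = x * y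
    have ew : (w : K) = N * y := rfl
    rw [ev, ev', ew]
    linear_combination x * y * hK
  have e : x = v + N * (x * t) := by
    rw [ev]; linear_combination -x * hK
  rw [e]
  exact add_mem v.2 (hN _ (mul_mem hxO (hle t.2)))

/-- Modulo `N O` the elements `x` and `y` of `O'` are integers `a` and `b` with `a b ≡ 1`, and `ℤ ∩
N O = N ℤ` turns this into a congruence of integers. -/
theorem exists_isCoprime_int
    (hadd : ∀ x ∈ O', ∃ a : ℤ, ∃ y ∈ O, x = a + N * y)
    (hdvd : ∀ n : ℤ, ∀ y ∈ O, (n : K) = N * y → (N : ℤ) ∣ n)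
    {x y z : O'} (h : x * y + N * z = 1) :
    ∃ a : ℤ, IsCoprime a (N : ℤ) ∧
      Subring.inclusion hle x - (a : O) ∈ Ideal.span {(N : O)} := by
  obtain ⟨a, r, hr, hx⟩ := hadd x x.2
  obtain ⟨b, s, hs, hy⟩ := hadd y y.2
  have hK : (x : K) * y + N * z = 1 := by simpa using congrArg (Subtype.val : O' → K) h
  refine ⟨a, ?_, Ideal.mem_span_singleton.2 ⟨⟨r, hr⟩, Subtype.ext ?_⟩⟩
  · obtain ⟨k, hk⟩ := hdvd (1 - a * b) (a * s + b * r + N * (r * s) + z)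
      (add_mem (add_mem (add_mem (mul_mem (intCast_mem _ _) hs) (mul_mem (intCast_mem _ _) hr))
        (mul_mem (natCast_mem _ _) (mul_mem hr hs))) (hle z.2))
      (by push_cast; rw [← hK, hx, hy]; ring)
    exact ⟨b, k, by linear_combination -hk⟩
  · simp [hx]

variable [IsFractionRing O' K] [IsFractionRing O K]

/-- Extension of ideals along the inclusion of two orders. -/
noncomputable def extendHom : IdealGroup O' →* IdealGroup O :=
  Units.map (FractionalIdeal.extendedHom' (K := K) K
    (nonZeroDivisors_le_comap_nonZeroDivisors_of_injective _
      (Subring.inclusion_injective hle))).toMonoidHom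

theorem coe_extendHom {u : IdealGroup O'} {𝔞 : Ideal O'} (hu : (u : FractionalIdeal O'⁰ K) = 𝔞) :
    (extendHom hle u : FractionalIdeal O⁰ K) = (𝔞.map (Subring.inclusion hle) : Ideal O) := by
  rw [← FractionalIdeal.extended_coeIdeal_eq_map (K := K) K
    (nonZeroDivisors_le_comap_nonZeroDivisors_of_injective _ (Subring.inclusion_injective hle)),
    ← hu]
  rfl

theorem coe_extendHom_span {u : IdealGroup O'} {α : O'}
    (hu : (u : FractionalIdeal O'⁰ K) = (Ideal.span {α} : Ideal O')) :
    (extendHom hle u : FractionalIdeal O⁰ K)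
      = (Ideal.span {Subring.inclusion hle α} : Ideal O) := by
  rw [coe_extendHom hle hu, Ideal.map_span, Set.image_singleton]

theorem map_idealsPrimeTo
    (hN : ∀ x ∈ O, (N : K) * x ∈ O')
    (hunit : ∀ I : FractionalIdeal O'⁰ K, IsProper I → IsUnit I) :
    (idealsPrimeTo O' N).map (extendHom hle) = idealsPrimeTo O N := by
  refine le_antisymm ?_ ?_
  · rw [idealsPrimeTo, MonoidHom.map_closure, Subgroup.closure_le]
    rintro _ ⟨u, ⟨𝔞, hu, -, ha⟩, rfl⟩
    exact mem_idealsPrimeTo (coe_extendHom hle hu) (isPrimeTo_map hle ha)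
  · rw [idealsPrimeTo, Subgroup.closure_le]
    rintro u ⟨𝔞, hu, hp, ha⟩
    have hv := (hunit _ (isProper_comap hle hN ha hp)).unit_spec
    refine ⟨(hunit _ (isProper_comap hle hN ha hp)).unit,
      mem_idealsPrimeTo hv (isPrimeTo_comap hle hN ha), Units.ext ?_⟩
    rw [coe_extendHom hle hv, map_comap_eq hle hN ha, hu]

/-- The quotient of `u` and `v` is a quotient of two integral ideals prime to `N`. Their extensions
agree, and contraction recovers the ideals. -/
theorem extendHom_injOn
    (hN : ∀ x ∈ O, (N : K) * x ∈ O')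
    {u v : IdealGroup O'} (hu : u ∈ idealsPrimeTo O' N)
    (hv : v ∈ idealsPrimeTo O' N) (h : extendHom hle u = extendHom hle v) : u = v := by
  rw [← mul_inv_eq_one]
  have h1 : extendHom hle (u * v⁻¹) = 1 := by rw [map_mul, map_inv, h, mul_inv_cancel]
  obtain ⟨w, w', 𝔞, 𝔟, e, hw, hw', ha, hb⟩ := exists_of_mem_idealsPrimeTo (mul_mem hu (inv_mem hv))
  rw [e] at h1 ⊢
  rw [map_mul, map_inv, mul_inv_eq_one] at h1
  have h2 := congrArg (Units.val) h1
  rw [coe_extendHom hle hw, coe_extendHom hle hw', FractionalIdeal.coeIdeal_inj] at h2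
  have h3 := congrArg (Ideal.comap (Subring.inclusion hle)) h2
  rw [comap_map_eq hle hN ha, comap_map_eq hle hN hb] at h3
  rw [mul_inv_eq_one]
  exact Units.ext (by rw [hw, hw', h3])

/-- Here `u = 𝔞 / 𝔟 = α / β`, where `α` and `β` need not be prime to `N`, and they are replaced as
follows. Take a nonzero `γ ∈ 𝔟` with `γ ≡ 1` modulo `N` and put `ε = α γ / β ∈ 𝔞`, so that `u = ε /
γ`. Likewise `ε₀ ∈ 𝔞` with `ε₀ ≡ 1` gives `γ₀ = β ε₀ / α ∈ 𝔟`, and `ε γ₀ = γ ε₀ ≡ 1` shows that `ε`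
is invertible modulo `N`. Both `ε` and `γ` are then congruent to integers prime to `N`. -/
theorem extendHom_mem_principalCongr
    (hadd : ∀ x ∈ O', ∃ a : ℤ, ∃ y ∈ O, x = a + N * y)
    (hdvd : ∀ n : ℤ, ∀ y ∈ O, (n : K) = N * y → (N : ℤ) ∣ n)
    {u : IdealGroup O'} (hu : u ∈ idealsPrimeTo O' N)
    (hP : u ∈ principalPrimeTo O' 1) : extendHom hle u ∈ principalCongr O N := by
  obtain ⟨w, w', 𝔞, 𝔟, rfl, hw, hw', ha, hb⟩ := exists_of_mem_idealsPrimeTo hu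
  obtain ⟨v, v', α, β, e, hv, hv'⟩ := exists_of_mem_principalPrimeTo_one hP
  have hα := ne_zero_of_units_eq_span hv
  have hβ := ne_zero_of_units_eq_span hv'
  have hab : Ideal.span {β} * 𝔞 = Ideal.span {α} * 𝔟 := by
    rw [← FractionalIdeal.coeIdeal_inj (K := K), FractionalIdeal.coeIdeal_mul,
      FractionalIdeal.coeIdeal_mul, ← hw, ← hw', ← hv, ← hv', ← Units.val_mul, ← Units.val_mul]
    rw [mul_inv_eq_iff_eq_mul] at e
    rw [e]
    congr 1
    rw [mul_comm v, mul_assoc, mul_comm v, ← mul_assoc, ← mul_assoc, mul_inv_cancel, one_mul,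
      mul_comm]
  obtain ⟨γ, hγ, hγ0, y, hy⟩ := hb.exists_ne_zero (ne_bot_of_units_eq hw')
  obtain ⟨ε₀, hε₀, y', hy'⟩ := isPrimeTo_iff_exists.1 ha
  obtain ⟨ε, hε, h1⟩ : ∃ ε ∈ 𝔞, β * ε = α * γ := by
    rw [← Ideal.mem_span_singleton_mul, hab, Ideal.mem_span_singleton_mul]
    exact ⟨γ, hγ, rfl⟩
  obtain ⟨γ₀, hγ₀, h2⟩ : ∃ γ₀ ∈ 𝔟, α * γ₀ = β * ε₀ := by
    rw [← Ideal.mem_span_singleton_mul, ← hab, Ideal.mem_span_singleton_mul]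
    exact ⟨ε₀, hε₀, rfl⟩
  have h3 : ε * γ₀ = γ * ε₀ := by
    refine mul_left_cancel₀ (mul_ne_zero hα hβ) ?_
    linear_combination α * γ₀ * h1 + α * γ * h2
  have hε0 : ε ≠ 0 := by
    rintro rfl
    rw [mul_zero] at h1
    exact mul_ne_zero hα hγ0 h1.symm
  have hε1 : ε * γ₀ + N * (y * ε₀ + y') = 1 := by
    rw [h3]; linear_combination ε₀ * hy + hy'
  have hγ1 : γ * 1 + N * y = 1 := by rw [mul_one, hy]
  obtain ⟨a, ha', haε⟩ := exists_isCoprime_int hle hadd hdvd hε1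
  obtain ⟨b, hb', hbγ⟩ := exists_isCoprime_int hle hadd hdvd hγ1
  have hu' : w * w'⁻¹ = principalUnit ε hε0 * (principalUnit γ hγ0)⁻¹ := by
    rw [e, mul_inv_eq_iff_eq_mul, mul_assoc, mul_comm _ v', ← mul_assoc, eq_mul_inv_iff_mul_eq]
    refine Units.ext ?_
    rw [Units.val_mul, Units.val_mul, hv, hv', coe_principalUnit, coe_principalUnit,
      ← FractionalIdeal.coeIdeal_mul, ← FractionalIdeal.coeIdeal_mul,
      Ideal.span_singleton_mul_span_singleton, Ideal.span_singleton_mul_span_singleton, ← h1,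
      mul_comm]
  rw [hu', map_mul, map_inv]
  exact mul_mem (Subgroup.subset_closure
      ⟨_, a, coe_extendHom_span hle (coe_principalUnit ε hε0), ha', haε⟩)
    (inv_mem (Subgroup.subset_closure
      ⟨_, b, coe_extendHom_span hle (coe_principalUnit γ hγ0), hb', hbγ⟩))

/-- A generator `α ≡ a` modulo `N O` already lies in `O'`, and `r a + s N = 1` shows that it
generates there an ideal prime to `N`. -/
theorem principalCongr_le_map
    (hN : ∀ x ∈ O, (N : K) * x ∈ O')
    :
    principalCongr O N ≤ (idealsPrimeTo O' N ⊓ principalPrimeTo O' 1).map (extendHom hle) := by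
  rw [principalCongr, Subgroup.closure_le]
  rintro u ⟨α, a, hu, ⟨r, s, hrs⟩, hα⟩
  obtain ⟨t, ht⟩ := Ideal.mem_span_singleton.1 hα
  have htK : (α : K) - a = N * t := by simpa using congrArg (Subtype.val : O → K) ht
  have hαO : (α : K) ∈ O' := by
    rw [eq_add_of_sub_eq htK]
    exact add_mem (hN _ t.2) (intCast_mem _ _)
  let α' : O' := ⟨α, hαO⟩
  have hα0 : α' ≠ 0 := by
    intro h0
    refine ne_zero_of_units_eq_span hu (Subtype.ext ?_)
    exact congrArg (Subtype.val : O' → K) h0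
  have hrsK : (r : K) * a + s * N = 1 := by exact_mod_cast congrArg (Int.cast : ℤ → K) hrs
  have hprime : IsPrimeTo (Ideal.span {α'}) N :=
    isPrimeTo_of_add_eq_one hN (x := r * α') (y := s - r * t)
      (Ideal.mem_span_singleton.2 (dvd_mul_left _ _)) (by
        have : (r : K) * α + N * (s - r * t) = 1 := by linear_combination hrsK + r * htK
        simpa [α'] using this)
  refine ⟨principalUnit α' hα0, ⟨mem_idealsPrimeTo (coe_principalUnit _ _) hprime,
    principalUnit_mem _ _⟩, Units.ext ?_⟩
  rw [coe_extendHom_span hle (coe_principalUnit _ _), hu]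
  rfl

theorem extendHom_mem_principalCongr_iff
    (hN : ∀ x ∈ O, (N : K) * x ∈ O')
    (hadd : ∀ x ∈ O', ∃ a : ℤ, ∃ y ∈ O, x = a + N * y)
    (hdvd : ∀ n : ℤ, ∀ y ∈ O, (n : K) = N * y → (N : ℤ) ∣ n)
    {u : IdealGroup O'} (hu : u ∈ idealsPrimeTo O' N) :
    extendHom hle u ∈ principalCongr O N ↔ u ∈ principalPrimeTo O' 1 := by
  refine ⟨fun h => ?_, extendHom_mem_principalCongr hle hadd hdvd hu⟩
  obtain ⟨v, ⟨hv, hvP⟩, e⟩ := principalCongr_le_map hle hN h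
  rwa [extendHom_injOn hle hN hu hv e.symm]

end Extension

/-! ### Orders in quadratic fields -/

section Quadratic

variable {K : Type*} [Field K] [NumberField K]

theorem isIntegral_of_mem_orderOfConductor {f : ℕ} {x : K} (hx : x ∈ orderOfConductor K f) :
    IsIntegral ℤ x := by
  obtain ⟨a, β, rfl⟩ := hx
  have h1 : IsIntegral ℤ (a : K) := isIntegral_algebraMap (R := ℤ) (x := a)
  have h2 : IsIntegral ℤ (f : K) := by
    simpa using isIntegral_algebraMap (R := ℤ) (A := K) (x := (f : ℤ))
  exact h1.add (h2.mul β.2)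

theorem isFractionRing_orderOfConductor {f : ℕ} (hf : 0 < f) :
    IsFractionRing (orderOfConductor K f) K := by
  refine IsFractionRing.of_field _ _ fun z => ?_
  have hfK : (f : K) ≠ 0 := by exact_mod_cast hf.ne'
  obtain ⟨x, y, hy, rfl⟩ := IsFractionRing.div_surjective (A := 𝓞 K) z
  refine ⟨⟨f * (x : K), 0, x, by simp⟩, ⟨f * (y : K), 0, y, by simp⟩, ?_⟩
  change (x : K) / y = f * x / (f * y)
  rw [mul_div_mul_left _ _ hfK]

/-- The number `n / N` is rational and integral over `ℤ`, hence an integer. -/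
theorem dvd_of_eq_mul_mem_orderOfConductor {f N : ℕ} (hN : 0 < N) (n : ℤ) (y : K)
    (hy : y ∈ orderOfConductor K f) (h : (n : K) = N * y) : (N : ℤ) ∣ n := by
  have hNK : (N : K) ≠ 0 := by exact_mod_cast hN.ne'
  have hNQ : (N : ℚ) ≠ 0 := by exact_mod_cast hN.ne'
  have e : y = algebraMap ℚ K (n / N) := by
    simp only [map_div₀, map_intCast, map_natCast]
    rw [h]; field_simp
  have hint := isIntegral_of_mem_orderOfConductor hy
  rw [e] at hint
  obtain ⟨m, hm⟩ := IsIntegrallyClosed.isIntegral_iff.1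
    ((isIntegral_algebraMap_iff (algebraMap ℚ K).injective).1 hint)
  refine ⟨m, ?_⟩
  have hm' : (m : ℚ) = n / N := by simpa using hm
  have : (n : ℚ) = N * m := by rw [hm']; field_simp
  exact_mod_cast this

variable [Algebra.IsQuadraticExtension ℚ K]

/-- Every class of invertible ideals contains an ideal relatively prime to `N`. -/
theorem exists_toPrincipalIdeal_mul_mem {f : ℕ} [IsFractionRing (orderOfConductor K f) K] {N : ℕ}
    (hN : 0 < N) (u : IdealGroup (orderOfConductor K f)) :
    ∃ x : Kˣ, toPrincipalIdeal _ K x * u ∈ idealsPrimeTo (orderOfConductor K f) N := by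
  let O := orderOfConductor K f
  let I : FractionalIdeal O⁰ K := u
  obtain ⟨α, hα, β, hβ, hαβ, hα0⟩ : ∃ α ∈ I, ∃ β ∈ I,
      (∀ x ∈ I, ∃ m n : ℤ, x = m * α + n * β) ∧ α ≠ 0 := by
    obtain ⟨α, hα, β, hβ, h⟩ := exists_two_generators I
    by_cases h0 : α = 0
    · refine ⟨β, hβ, α, hα, fun x hx => ?_, ?_⟩
      · obtain ⟨m, n, e⟩ := h x hx
        exact ⟨n, m, by rw [e, add_comm]⟩
      · rintro rfl
        refine u.ne_zero (FractionalIdeal.eq_zero_iff.2 fun x hx => ?_)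
        obtain ⟨m, n, e⟩ := h x hx
        rw [e, h0]; simp
    · exact ⟨α, hα, β, hβ, h, h0⟩
  obtain ⟨a, b, c, p, q, r, hτ, hpqr⟩ := exists_primitive_relation (β / α)
  have hβτ : β = α * (β / α) := by field_simp
  generalize β / α = τ at hτ hβτ
  subst hβτ
  -- Multiplication by `a τ` preserves `I`, and an invertible ideal is proper.
  have hω : (a : K) * τ ∈ O := by
    refine (isProper_of_isUnit u.isUnit _).2 fun y hy => ?_
    obtain ⟨m, n, rfl⟩ := hαβ y hy
    have : (a : K) * τ * (m * α + n * (α * τ))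
        = ((a * m - b * n : ℤ) : K) * (α * τ) + ((-c * n : ℤ) : K) * α := by
      push_cast
      linear_combination (n : K) * α * hτ
    rw [this]
    exact add_mem_fractionalIdeal I _ _ (intCast_mul_mem I _ _ hβ) (intCast_mul_mem I _ _ hα)
  -- The factor 2 in the modulus excludes the value `0` when `N = 1`.
  obtain ⟨x, y, -, hxy⟩ := exists_isCoprime_value (a := a) (b := b) (c := c) (M := 2 * N)
    (fun l hl h1 h2 h3 => by
      have : (l : ℤ) ∣ 1 := by
        rw [← hpqr]
        exact dvd_add (dvd_add (h1.mul_left _) (h2.mul_left _)) (h3.mul_left _)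
      exact (Nat.prime_iff_prime_int.1 hl).not_isUnit (isUnit_of_dvd_one this)) (by omega)
  push_cast at hxy
  set v := a * x ^ 2 + b * x * y + c * y ^ 2 with hv
  have hv0 : v ≠ 0 := by
    intro h0
    rw [h0, isCoprime_zero_left] at hxy
    have := Int.isUnit_iff.1 hxy
    omega
  obtain ⟨s, t, hst⟩ := hxy.of_mul_right_right
  -- the element `g` satisfies `g I ⊆ O`, and `g I` contains the integer `v`
  let g : K := (a * x + (b + a * τ) * y) / α
  have hgα : g * α = a * x + (b + a * τ) * y := div_mul_cancel₀ _ hα0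
  -- The choice of `g` comes from the factorization `a x² + b x y + c y² = (x - y τ) (a x + (b + a
  -- τ) y)`: the first factor times `α` lies in `I`, and the second divided by `α` is `g`.
  have hgv : g * (x * α + ((-y : ℤ) : K) * (α * τ)) = v := by
    rw [hv]
    push_cast
    linear_combination (x - y * τ : K) * hgα - y ^ 2 * hτ
  have hg0 : g ≠ 0 := by
    intro h0
    rw [h0, zero_mul] at hgv
    exact hv0 (by exact_mod_cast hgv.symm)
  have hgI : FractionalIdeal.spanSingleton O⁰ g * I ≤ 1 := by
    rw [FractionalIdeal.spanSingleton_mul_le_iff]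
    intro z hz
    obtain ⟨m, n, rfl⟩ := hαβ z hz
    refine (FractionalIdeal.mem_one_iff _).2
      ⟨((m * (a * x + b * y) - n * c * y : ℤ) : O) + ((m * y + n * x : ℤ) : O) * ⟨_, hω⟩, ?_⟩
    change (((m * (a * x + b * y) - n * c * y : ℤ) : O) : K)
      + (((m * y + n * x : ℤ) : O) : K) * (a * τ) = g * (m * α + n * (α * τ))
    push_cast
    linear_combination -(m + n * τ : K) * hgα - n * y * hτ
  obtain ⟨𝔞, h𝔞⟩ := FractionalIdeal.le_one_iff_exists_coeIdeal.1 hgI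
  refine ⟨Units.mk0 g hg0, mem_idealsPrimeTo (𝔞 := 𝔞) ?_ ?_⟩
  · rw [Units.val_mul, coe_toPrincipalIdeal, h𝔞]; rfl
  · have hmem : (v : O) ∈ 𝔞 := by
      have h1 : (v : K) ∈ (𝔞 : FractionalIdeal O⁰ K) := by
        rw [h𝔞, ← hgv, FractionalIdeal.mem_singleton_mul]
        exact ⟨_, add_mem_fractionalIdeal I _ _ (intCast_mul_mem I _ _ hα)
          (intCast_mul_mem I _ _ hβ), rfl⟩
      obtain ⟨z, hz, e⟩ := (FractionalIdeal.mem_coeIdeal _).1 h1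
      have : z = (v : O) := Subtype.ext (e.trans (by simp))
      rwa [← this]
    refine isPrimeTo_iff_exists.2 ⟨s * v, 𝔞.mul_mem_left _ hmem, t, ?_⟩
    have := congrArg (Int.cast : ℤ → O) hst
    push_cast at this
    linear_combination this

theorem nonempty_classGroup_mulEquiv {f N : ℕ} (hf : 0 < f) (hN : 0 < N) :
    Nonempty (IdealClassGroupCongr (orderOfConductor K f) N ≃*
      IdealClassGroup (orderOfConductor K (N * f))) := by
  have := isFractionRing_orderOfConductor (K := K) hf
  have := isFractionRing_orderOfConductor (K := K) (Nat.mul_pos hN hf)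
  have hle : orderOfConductor K (N * f) ≤ orderOfConductor K f := by
    rintro _ ⟨a, β, rfl⟩
    exact ⟨a, N * β, by push_cast; ring⟩
  have hNO : ∀ x ∈ orderOfConductor K f, (N : K) * x ∈ orderOfConductor K (N * f) := by
    rintro _ ⟨a, β, rfl⟩
    exact ⟨N * a, β, by push_cast; ring⟩
  have hadd : ∀ x ∈ orderOfConductor K (N * f), ∃ a : ℤ, ∃ y ∈ orderOfConductor K f,
      x = a + N * y := by
    rintro _ ⟨a, β, rfl⟩
    exact ⟨a, f * β, ⟨0, β, by simp⟩, by push_cast; ring⟩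
  refine nonempty_quotient_mulEquiv (extendHom hle) (J' := idealsPrimeTo _ N) ?_
    (map_idealsPrimeTo hle hNO fun I => (isUnit_iff_isProper I).2) (fun u _ => ?_)
    (fun u hu => extendHom_mem_principalCongr_iff hle hNO hadd
      (dvd_of_eq_mul_mem_orderOfConductor hN) hu)
  · refine Subgroup.closure_mono ?_
    rintro u ⟨𝔞, hu, hp, -⟩
    exact ⟨𝔞, hu, hp, isPrimeTo_one _⟩
  · obtain ⟨x, hx⟩ := exists_toPrincipalIdeal_mul_mem hN u
    refine ⟨_, hx, ?_⟩
    rw [mul_inv_rev, mul_comm u⁻¹, mul_assoc, inv_mul_cancel, mul_one]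
    exact inv_mem (toPrincipalIdeal_mem x)

end Quadratic

end GammaForms

theorem mainTheorem2 :
    (∀ (K : Type*) [Field K] [NumberField K] [Algebra.IsQuadraticExtension ℚ K]
      [NumberField.IsTotallyComplex K] (f N : ℕ), 0 < f → 0 < N →
      Nonempty (GammaForms.IdealClassGroupCongr (GammaForms.orderOfConductor K f) N ≃*
        GammaForms.IdealClassGroup (GammaForms.orderOfConductor K (N * f)))) ∧
    (∀ (D : ℤ) (N : ℕ), D < 0 → (D % 4 = 0 ∨ D % 4 = 1) → 0 < N →
      ∃ (G : CommGroup (GammaForms.FormClass D N))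
        (H : CommGroup (GammaForms.FormClass (D * (N : ℤ) ^ 2) 1)),
        GammaForms.IsDirichletGroup G ∧ GammaForms.IsDirichletGroup H ∧
        Nonempty (GammaForms.FormClass D N ≃* GammaForms.FormClass (D * (N : ℤ) ^ 2) 1)) :=
  ⟨fun _ _ _ _ _ _ _ hf hN => GammaForms.nonempty_classGroup_mulEquiv hf hN,
    fun _ _ hD hD4 hN => GammaForms.exists_dirichletGroup_mulEquiv hD hD4 hN⟩
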